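/- Let $m,n\geq 0$ be integers with $m\neq n$. Put $\bar i=0$ for $1\le i\le m$ and $\bar i=1$ for $m<i\le m+n$. Let $e_{ij}$ be the matrix units of the superalgebra $\operatorname{End}\mathbb{C}^{m|n}$, let $P=\sum_{i,j}(-1)^{\bar j}e_{ij}\otimes e_{ji}$, $R(u)=1-Pu^{-1}$, and let $\overline R(u)=g(u)R(u)$, where $g(u)\in 1+u^{-1}\mathbb{C}[[u^{-1}]]$ is the unique series with $g(u+m-n)=(1-u^{-2})g(u)$. The double Yangian $\mathrm{DY}(\mathfrak{gl}_{m|n})$ is the $\mathbb{Z}_2$-graded unital associative $\mathbb{C}$-algebra generated by an even central element $C$ and elements $t_{ij}^{(r)},t_{ij}^{(-r)}$ of parity $\bar i+\bar j$ ($1\le i,j\le m+n$, $r\ge 1$), subject to $$R(u-v)T_1(u)T_2(v)=T_2(v)T_1(u)R(u-v),\qquad R(u-v)T^+_1(u)T^+_2(v)=T^+_2(v)T^+_1(u)R(u-v),$$ $$\overline R(u-v+C/2)\,T_1(u)T_2^+(v)=T_2^+(v)T_1(u)\,\overline R(u-v-C/2),$$ where $T(u)=\sum_{i,j}(-1)^{\bar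 i\bar j+\bar j}e_{ij}\otimes t_{ij}(u)$, $T^+(u)=\sum_{i,j}(-1)^{\bar i\bar j+\bar j}e_{ij}\otimes t^+_{ij}(u)$, $t_{ij}(u)=\delta_{ij}+\sum_{r\ge1}t_{ij}^{(r)}u^{-r}$, $t^+_{ij}(u)=\delta_{ij}-\sum_{r\ge1}t_{ij}^{(-r)}u^{r-1}$, the subscripts indicate the tensor factor $\operatorname{End}\mathbb{C}^{m|n}$, and $\overline R(u-v\pm C/2)$ is expanded in nonnegative powers of $u^{-1}$, $v$ and $C$. Let $\mathrm Y$ and $\mathrm Y^+$ be the subalgebras generated by all $t_{ij}^{(r)}$ and by all $t_{ij}^{(-r)}$ ($r\ge1$), respectively. Let $\widetilde{\mathrm Y}^+$ be the completion of $\mathrm Y^+$ with respect to the descending filtration in which $t_{ij}^{(-r)}$ has degree $r$. The extended double Yangian $\widetilde{\mathrm{DY}}(\mathfrak{gl}_{m|n})$ is the algebra of all finite $\mathbb{C}[C]$-linear combinations of products $xy$ with $x\in\widetilde{\mathrm Y}^+$, $y\in\mathrm Y$, with the multiplication extended by continuity. Let $\tau\colon e_{ij}\mapsto(-1)^{\bar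 i\bar j+\bar i}e_{ji}$, and let $\tau_2$ denote $\tau$ applied to the second tensor factor. Then there exists a unique series $z^+(u)\in\widetilde{\mathrm Y}^+[[u]]$ such that $$P^{\tau_2}\,T_1^+(u+m-n)\,\bigl(T_2^+(u)^{-1}\bigr)^{\tau}=P^{\tau_2}\otimes z^+(u).$$ For $c\in\mathbb{C}$ let the extended vacuum module $\widetilde{\mathrm V}_c(\mathfrak{gl}_{m|n})$ at the level $c$ be the quotient of $\widetilde{\mathrm{DY}}(\mathfrak{gl}_{m|n})$ by its left ideal generated by $C-c\cdot1$ and all $t_{ij}^{(r)}$ ($1\le i,j\le m+n$, $r\ge1$), and let $\mathbf 1$ be the image of the unit. Then, for every $c\in\mathbb{C}$, all coefficients of the series $z^+(u)\mathbf 1$ belong to the subspace of invariants $$\mathfrak z(\widetilde{\mathrm V}_c(\mathfrak{gl}_{m|n}))=\{v\in\widetilde{\mathrm V}_c(\mathfrak{gl}_{m|n}) : t_{ij}^{(r)}v=0\ \text{ for all } i,j=1,\dots,m+n \text{ and } r\ge1\}.$$ -/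

import Mathlib

/-! ## Super matrices with coefficients in an algebra -/

/-- Index set `{1, …, m+n}` of the standard basis of `ℂ^{m|n}`. -/
abbrev SIdx (m n : ℕ) : Type := Fin (m + n)

/-- Parity of a basis index: `0` for the first `m` indices, `1` for the last `n`. -/
def par {m n : ℕ} (i : SIdx m n) : ℕ := if i.val < m then 0 else 1

/-- Even elements `∑ e_{ij} ⊗ e_{kl} ⊗ x_{ijkl}` of `End ℂ^{m|n} ⊗ End ℂ^{m|n} ⊗ S`, recorded by
their coefficients `x_{ijkl}`; evenness means that `x_{ijkl}` has parity `ī + j̄ + k̄ + l̄`. All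
matrices which occur below are of this kind. -/
abbrev SMat (m n : ℕ) (S : Type*) : Type _ := SIdx m n → SIdx m n → SIdx m n → SIdx m n → S

namespace SMat

variable {m n : ℕ} {S : Type*} [Ring S]

/-- The product of even elements of the tensor product of superalgebras
`End ℂ^{m|n} ⊗ End ℂ^{m|n} ⊗ S`, by the sign rule
`(a ⊗ b ⊗ x) (a' ⊗ b' ⊗ y) = (-1)^{|a'| (|b| + |x|) + |b'| |x|} a a' ⊗ b b' ⊗ x y`
with `a = e_{ip}`, `b = e_{kq}`, `a' = e_{pj}`, `b' = e_{ql}` and `|x| = ī + p̄ + k̄ + q̄`. -/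
def mul (X Y : SMat m n S) : SMat m n S := fun i j k l =>
  ∑ p : SIdx m n, ∑ q : SIdx m n,
    (-1) ^ ((par p + par j) * ((par k + par q) + (par i + par p + par k + par q)) +
        (par q + par l) * (par i + par p + par k + par q)) *
      (X i p k q * Y p j q l)

infixl:70 " ⊙ₛ " => SMat.mul

/-- The identity `1 ⊗ 1 ⊗ 1`. -/
def one : SMat m n S := fun i j k l => if i = j ∧ k = l then 1 else 0

/-- `s X`, for an even central element `s`. -/
def scale (s : S) (X : SMat m n S) : SMat m n S := fun i j k l => s * X i j k l

/-- The super permutation operator `P = ∑ e_{ij} ⊗ e_{ji} (-1)^{j̄}`. -/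
def P : SMat m n S := fun i j k l => if k = j ∧ l = i then (-1) ^ par j else 0

/-- `X ↦ X^{τ₂}`, where `τ : e_{ij} ↦ (-1)^{ī j̄ + ī} e_{ji}` is applied on the second factor. -/
def tau₂ (X : SMat m n S) : SMat m n S := fun i j k l =>
  (-1) ^ (par l * par k + par l) * X i j l k

/-- `T₁ = ∑ (-1)^{ī j̄ + j̄} e_{ij} ⊗ 1 ⊗ t_{ij}`. -/
def fst (t : SIdx m n → SIdx m n → S) : SMat m n S := fun i j k l =>
  if k = l then (-1) ^ (par i * par j + par j) * t i j else 0

/-- `T₂ = ∑ (-1)^{ī j̄ + j̄} 1 ⊗ e_{ij} ⊗ t_{ij}`. -/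
def snd (t : SIdx m n → SIdx m n → S) : SMat m n S := fun i j k l =>
  if i = j then (-1) ^ (par k * par l + par l) * t k l else 0

end SMat

/-! ## The normalized `R`-matrix -/

/-- For a series `f` in `u⁻¹` (the variable of the power series is `u⁻¹`), the series
`f(u - a) = ∑_k f_k (u - a)^{-k}` expanded in `u⁻¹`, where
`(u - a)^{-k} = ∑_{d ≥ k} binom(d-1, d-k) a^{d-k} u^{-d}`. -/
noncomputable def shiftInv {B : Type*} [Ring B] [Algebra ℂ B] (f : PowerSeries ℂ) (a : B) :
    PowerSeries B :=
  PowerSeries.mk fun d => ∑ k ∈ Finset.range (d + 1),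
    (PowerSeries.coeff k f * ((d - 1).choose (d - k) : ℂ)) • a ^ (d - k)

/-- Coefficients of the series `g(u)` below, by the recursion which the functional equation
imposes on them. -/
noncomputable def gCoeff (N : ℂ) : ℕ → ℂ
  | 0 => 1
  | q + 1 => (gCoeff N q + ∑ k : Fin (q + 1),
      gCoeff N k * ((q + 1).choose (q + 2 - k) : ℂ) * (-N) ^ (q + 2 - (k : ℕ))) / ((q + 1) * N)
decreasing_by all_goals first | exact k.2 | omega

/-- The series `g(u) ∈ 1 + u⁻¹ℂ[[u⁻¹]]` with `g(u + N) = (1 - u⁻²) g(u)`, where `N = m - n ≠ 0`;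
the variable of the power series is `u⁻¹`. -/
noncomputable def gSeries (N : ℂ) : PowerSeries ℂ := PowerSeries.mk (gCoeff N)

theorem gSeries_constantCoeff (N : ℂ) : PowerSeries.coeff 0 (gSeries N) = 1 := by
  simp [gSeries, gCoeff]

/-- The functional equation of `g`. -/
theorem gSeries_spec (N : ℂ) (hN : N ≠ 0) :
    shiftInv (gSeries N) (-N) = (1 - PowerSeries.X ^ 2) * gSeries N := by
  ext d
  rw [sub_mul, one_mul, map_sub, shiftInv, PowerSeries.coeff_mk]
  match d with
  | 0 => simp [gSeries, gCoeff, PowerSeries.coeff_X_pow_mul']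
  | 1 => simp [gSeries, gCoeff, PowerSeries.coeff_X_pow_mul', Finset.sum_range_succ]
  | q + 2 =>
    have hq : ((q : ℂ) + 1) ≠ 0 := by exact_mod_cast Nat.succ_ne_zero q
    have hrec : gCoeff N (q + 1) * ((q + 1) * N) = gCoeff N q + ∑ k ∈ Finset.range (q + 1),
        gCoeff N k * ((q + 1).choose (q + 2 - k) : ℂ) * (-N) ^ (q + 2 - k) := by
      rw [Finset.sum_range, gCoeff]
      field_simp
    rw [PowerSeries.coeff_X_pow_mul, Finset.sum_range_succ, Finset.sum_range_succ]
    simp only [gSeries, PowerSeries.coeff_mk, smul_eq_mul,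
      show q + 2 - 1 = q + 1 by omega, show q + 2 - (q + 1) = 1 by omega, Nat.sub_self,
      Nat.choose_one_right, Nat.choose_zero_right, pow_zero, pow_one]
    push_cast
    linear_combination -hrec

/-- The functional equation and the constant term determine `g`. -/
theorem gSeries_unique (N : ℂ) (hN : N ≠ 0) (f : PowerSeries ℂ) (h0 : PowerSeries.coeff 0 f = 1)
    (hf : shiftInv f (-N) = (1 - PowerSeries.X ^ 2) * f) : f = gSeries N := by
  ext d
  induction d using Nat.strong_induction_on with
  | _ d ih =>
  match d with
  | 0 => rw [h0, gSeries_constantCoeff]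
  | q + 1 =>
    have key : ∀ h : PowerSeries ℂ, shiftInv h (-N) = (1 - PowerSeries.X ^ 2) * h →
        PowerSeries.coeff (q + 1) h * ((q + 1) * N) = PowerSeries.coeff q h +
          ∑ k ∈ Finset.range (q + 1), PowerSeries.coeff k h *
            ((q + 1).choose (q + 2 - k) : ℂ) * (-N) ^ (q + 2 - k) := by
      intro h hh
      have := congrArg (PowerSeries.coeff (q + 2)) hh
      rw [sub_mul, one_mul, map_sub, shiftInv, PowerSeries.coeff_mk, PowerSeries.coeff_X_pow_mul,
        Finset.sum_range_succ, Finset.sum_range_succ] at this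
      simp only [smul_eq_mul, show q + 2 - 1 = q + 1 by omega,
        show q + 2 - (q + 1) = 1 by omega, Nat.sub_self,
        Nat.choose_one_right, Nat.choose_zero_right, pow_zero, pow_one] at this
      push_cast at this
      linear_combination -this
    have hq : ((q : ℂ) + 1) * N ≠ 0 :=
      mul_ne_zero (by exact_mod_cast Nat.succ_ne_zero q) hN
    refine mul_right_cancel₀ hq ?_
    rw [key f hf, key _ (gSeries_spec N hN), ih q (Nat.lt_succ_self q)]
    congr 1
    refine Finset.sum_congr rfl fun k hk => ?_
    rw [ih k (Finset.mem_range.1 hk)]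

/-- The normalized `R`-matrix `R̄(u - a) = g(u - a) (1 - P (u - a)⁻¹)`, expanded in `u⁻¹`. -/
noncomputable def Rbar (m n : ℕ) {B : Type*} [Ring B] [Algebra ℂ B] (a : B) :
    SMat m n (PowerSeries B) :=
  SMat.scale (shiftInv (gSeries ((m : ℂ) - n)) a) SMat.one -
    SMat.scale (shiftInv (PowerSeries.X * gSeries ((m : ℂ) - n)) a) SMat.P

/-! ## The double Yangian -/

/-- Generators of the double Yangian: `c` is `C`, `pos r i j` is `t_{ij}^{(r+1)}` and `neg r i j`
is `t_{ij}^{(-r-1)}`, for `r = 0, 1, 2, …`. -/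
inductive DYGen (m n : ℕ) : Type
  | c : DYGen m n
  | pos (r : ℕ) (i j : SIdx m n) : DYGen m n
  | neg (r : ℕ) (i j : SIdx m n) : DYGen m n

section Series

variable {m n : ℕ} {A : Type*} [Ring A]

/-- `t_{ij}(u) = δ_{ij} + ∑_{r ≥ 1} t_{ij}^{(r)} u^{-r}`, as a power series in `u⁻¹`. -/
noncomputable def tSeries (x : ℕ → SIdx m n → SIdx m n → A) (i j : SIdx m n) : PowerSeries A :=
  (if i = j then 1 else 0) + PowerSeries.X * PowerSeries.mk fun r => x r i j

/-- `t⁺_{ij}(u) = δ_{ij} - ∑_{r ≥ 1} t_{ij}^{(-r)} u^{r-1}`, as a power series in `u`. -/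
noncomputable def tPlusSeries (x : ℕ → SIdx m n → SIdx m n → A) (i j : SIdx m n) :
    PowerSeries A :=
  (if i = j then 1 else 0) - PowerSeries.mk fun r => x r i j

/-- A series in the first (outer) of two variables. -/
noncomputable def inFst (f : PowerSeries A) : PowerSeries (PowerSeries A) :=
  PowerSeries.map PowerSeries.C f

/-- A series in the second (inner) of two variables. -/
noncomputable def inSnd (f : PowerSeries A) : PowerSeries (PowerSeries A) := PowerSeries.C f

/-- `(u - v) R(u - v)` multiplied by `u⁻¹ v⁻¹`, that is `v⁻¹ - u⁻¹ - u⁻¹ v⁻¹ P`, as a series in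
the outer variable `u⁻¹` and the inner variable `v⁻¹`. -/
noncomputable def RYang (m n : ℕ) (A : Type*) [Ring A] :
    SMat m n (PowerSeries (PowerSeries A)) :=
  SMat.scale (inSnd PowerSeries.X - inFst PowerSeries.X) SMat.one -
    SMat.scale (inFst PowerSeries.X * inSnd PowerSeries.X) SMat.P

/-- `(u - v) R(u - v) = u - v - P`, in the outer variable `u` and the inner variable `v`. -/
noncomputable def RDual (m n : ℕ) (A : Type*) [Ring A] :
    SMat m n (PowerSeries (PowerSeries A)) :=
  SMat.scale (inFst PowerSeries.X - inSnd PowerSeries.X) SMat.one - SMat.P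

variable (m n A) in
/-- `R̄(u - v + c)` in the outer variable `u⁻¹` and the inner variable `v`. -/
noncomputable def RMixed [Algebra ℂ A] (c : A) : SMat m n (PowerSeries (PowerSeries A)) :=
  Rbar m n (PowerSeries.X - PowerSeries.C c)

end Series

/-- The coefficient of the `a`-th power of the outer and the `b`-th power of the inner variable. -/
noncomputable def coeff₂ {A : Type*} [Ring A] (a b : ℕ) (f : PowerSeries (PowerSeries A)) : A :=
  PowerSeries.coeff b (PowerSeries.coeff a f)

/-- The free algebra on the generators of the double Yangian. -/
abbrev DYFree (m n : ℕ) : Type := FreeAlgebra ℂ (DYGen m n)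

namespace DYFree

variable (m n : ℕ)

/-- The generator `C`. -/
noncomputable def c : DYFree m n := FreeAlgebra.ι ℂ DYGen.c

/-- The matrix entries of `T(u)`. -/
noncomputable def t : SIdx m n → SIdx m n → PowerSeries (DYFree m n) :=
  tSeries fun r i j => FreeAlgebra.ι ℂ (DYGen.pos r i j)

/-- The matrix entries of `T⁺(u)`. -/
noncomputable def tPlus : SIdx m n → SIdx m n → PowerSeries (DYFree m n) :=
  tPlusSeries fun r i j => FreeAlgebra.ι ℂ (DYGen.neg r i j)

end DYFree

open DYFree in
/-- The defining relations of the double Yangian, coefficient by coefficient: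
* `C` is central;
* `R(u-v) T₁(u) T₂(v) = T₂(v) T₁(u) R(u-v)`, multiplied by `u - v`;
* `R(u-v) T₁⁺(u) T₂⁺(v) = T₂⁺(v) T₁⁺(u) R(u-v)`, multiplied by `u - v`;
* `R̄(u-v+C/2) T₁(u) T₂⁺(v) = T₂⁺(v) T₁(u) R̄(u-v-C/2)`. -/
inductive DYRel (m n : ℕ) : DYFree m n → DYFree m n → Prop
  | central (x : DYGen m n) : DYRel m n (c m n * FreeAlgebra.ι ℂ x) (FreeAlgebra.ι ℂ x * c m n)
  | yangian (i j k l : SIdx m n) (a b : ℕ) : DYRel m n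
      (coeff₂ a b ((RYang m n _ ⊙ₛ SMat.fst (fun p q => inFst (t m n p q)) ⊙ₛ
        SMat.snd (fun p q => inSnd (t m n p q))) i j k l))
      (coeff₂ a b ((SMat.snd (fun p q => inSnd (t m n p q)) ⊙ₛ
        SMat.fst (fun p q => inFst (t m n p q)) ⊙ₛ RYang m n _) i j k l))
  | dual (i j k l : SIdx m n) (a b : ℕ) : DYRel m n
      (coeff₂ a b ((RDual m n _ ⊙ₛ SMat.fst (fun p q => inFst (tPlus m n p q)) ⊙ₛ
        SMat.snd (fun p q => inSnd (tPlus m n p q))) i j k l))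
      (coeff₂ a b ((SMat.snd (fun p q => inSnd (tPlus m n p q)) ⊙ₛ
        SMat.fst (fun p q => inFst (tPlus m n p q)) ⊙ₛ RDual m n _) i j k l))
  | mixed (i j k l : SIdx m n) (a b : ℕ) : DYRel m n
      (coeff₂ a b ((RMixed m n _ ((1 / 2 : ℂ) • c m n) ⊙ₛ
        SMat.fst (fun p q => inFst (t m n p q)) ⊙ₛ
        SMat.snd (fun p q => inSnd (tPlus m n p q))) i j k l))
      (coeff₂ a b ((SMat.snd (fun p q => inSnd (tPlus m n p q)) ⊙ₛ
        SMat.fst (fun p q => inFst (t m n p q)) ⊙ₛ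
        RMixed m n _ (-((1 / 2 : ℂ) • c m n))) i j k l))

/-- The double Yangian `DY(gl_{m|n})`. -/
def DY (m n : ℕ) : Type := RingQuot (DYRel m n)

namespace DY

variable (m n : ℕ)

noncomputable instance : Ring (DY m n) := inferInstanceAs (Ring (RingQuot (DYRel m n)))

noncomputable instance : Algebra ℂ (DY m n) :=
  inferInstanceAs (Algebra ℂ (RingQuot (DYRel m n)))

/-- The canonical projection from the free algebra. -/
noncomputable def proj : DYFree m n →ₐ[ℂ] DY m n := RingQuot.mkAlgHom ℂ (DYRel m n)

/-- The central element `C`. -/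
noncomputable def c : DY m n := proj m n (DYFree.c m n)

variable {m n}

/-- `tPos r i j = t_{ij}^{(r+1)}`. -/
noncomputable def tPos (r : ℕ) (i j : SIdx m n) : DY m n :=
  proj m n (FreeAlgebra.ι ℂ (DYGen.pos r i j))

/-- `tNeg r i j = t_{ij}^{(-r-1)}`. -/
noncomputable def tNeg (r : ℕ) (i j : SIdx m n) : DY m n :=
  proj m n (FreeAlgebra.ι ℂ (DYGen.neg r i j))

/-! ### The topology given by the descending filtration of the dual Yangian -/

variable (m n)

/-- The `p`-th term of the descending filtration of the subalgebra generated by all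
`t_{ij}^{(-r)}`, where `t_{ij}^{(-r)}` has degree `r`: the span of all monomials
`t_{i₁j₁}^{(-r₁)} ⋯ t_{i_kj_k}^{(-r_k)}` with `r₁ + ⋯ + r_k ≥ p`. -/
noncomputable def dualFiltration (p : ℕ) : Submodule ℂ (DY m n) :=
  Submodule.span ℂ {x | ∃ L : List (ℕ × SIdx m n × SIdx m n),
    p ≤ (L.map fun s => s.1 + 1).sum ∧ x = (L.map fun s => tNeg s.1 s.2.1 s.2.2).prod}

/-- The right ideal of the double Yangian generated by the `p`-th term of the filtration. -/
noncomputable def nbhd (p : ℕ) : Submodule ℂ (DY m n) := dualFiltration m n p * ⊤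


variable {m n}

theorem nbhd_anti {p q : ℕ} (h : p ≤ q) : nbhd m n q ≤ nbhd m n p :=
  mul_le_mul' (Submodule.span_mono fun _ ⟨L, hL, hx⟩ => ⟨L, h.trans hL, hx⟩) le_rfl

theorem nbhd_mul {p : ℕ} {x : DY m n} (hx : x ∈ nbhd m n p) (y : DY m n) :
    x * y ∈ nbhd m n p := by
  have := Submodule.mul_mem_mul hx (Submodule.mem_top (x := y) (R := ℂ))
  rw [nbhd, mul_assoc] at this
  exact (mul_le_mul' le_rfl le_top : dualFiltration m n p * (⊤ * ⊤) ≤ _) this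

theorem prod_mem_nbhd {p : ℕ} (L : List (ℕ × SIdx m n × SIdx m n))
    (hL : p ≤ (L.map fun s => s.1 + 1).sum) :
    (L.map fun s => tNeg s.1 s.2.1 s.2.2).prod ∈ nbhd m n p := by
  have := Submodule.mul_mem_mul (Submodule.subset_span ⟨L, hL, rfl⟩ :
    (L.map fun s => tNeg s.1 s.2.1 s.2.2).prod ∈ dualFiltration m n p)
    (Submodule.mem_top (x := (1 : DY m n)) (R := ℂ))
  rwa [mul_one] at this

/-- To check that left multiplication by `z` maps one neighbourhood to another, it suffices to
look at monomials. -/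
theorem mul_nbhd_of {p q : ℕ} {z : DY m n}
    (h : ∀ L : List (ℕ × SIdx m n × SIdx m n), q ≤ (L.map fun s => s.1 + 1).sum →
      z * (L.map fun s => tNeg s.1 s.2.1 s.2.2).prod ∈ nbhd m n p)
    {x : DY m n} (hx : x ∈ nbhd m n q) : z * x ∈ nbhd m n p := by
  have h1 : ∀ a ∈ dualFiltration m n q, z * a ∈ nbhd m n p := by
    intro a ha
    induction ha using Submodule.span_induction with
    | mem a ha =>
      obtain ⟨L, hL, rfl⟩ := ha
      exact h L hL
    | zero => simp
    | add a b _ _ ha hb => rw [mul_add]; exact add_mem ha hb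
    | smul c a _ ha => rw [mul_smul_comm]; exact Submodule.smul_mem _ _ ha
  induction hx using Submodule.mul_induction_on' with
  | mem_mul_mem a ha b hb => rw [← mul_assoc]; exact nbhd_mul (h1 a ha) b
  | add a _ b _ ha hb => rw [mul_add]; exact add_mem ha hb

theorem nbhd_zero : nbhd m n 0 = ⊤ := by
  refine eq_top_iff.2 fun x _ => ?_
  have := nbhd_mul (prod_mem_nbhd (m := m) (n := n) (p := 0) [] (Nat.zero_le _)) x
  simpa using this

theorem tNeg_mul_nbhd {p : ℕ} (r : ℕ) (i j : SIdx m n) {x : DY m n} (hx : x ∈ nbhd m n p) :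
    tNeg r i j * x ∈ nbhd m n (p + r + 1) := by
  refine mul_nbhd_of (fun L hL => ?_) hx
  have := prod_mem_nbhd (p := p + r + 1) ((r, i, j) :: L)
    (by simp only [List.map_cons, List.sum_cons]; omega)
  simpa using this

theorem central_mul_nbhd {p : ℕ} {z : DY m n} (hz : z ∈ Subalgebra.center ℂ (DY m n))
    {x : DY m n} (hx : x ∈ nbhd m n p) : z * x ∈ nbhd m n p := by
  rw [← Subalgebra.mem_center_iff.1 hz x]
  exact nbhd_mul hx z

theorem proj_surjective : Function.Surjective (proj m n) := RingQuot.mkAlgHom_surjective ℂ _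

theorem c_mem_center : c m n ∈ Subalgebra.center ℂ (DY m n) := by
  rw [Subalgebra.mem_center_iff]
  intro x
  obtain ⟨x, rfl⟩ := proj_surjective x
  induction x using FreeAlgebra.induction with
  | grade0 r => rw [AlgHom.commutes]; exact Algebra.commutes r _
  | grade1 g =>
    have := RingQuot.mkAlgHom_rel ℂ (DYRel.central (m := m) (n := n) g)
    rw [map_mul, map_mul] at this
    exact this.symm
  | mul a b ha hb => rw [map_mul, mul_assoc, hb, ← mul_assoc, ha, mul_assoc]
  | add a b ha hb => rw [map_add, add_mul, mul_add, ha, hb]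


/-! ### Left multiplication is continuous -/

/-- An auxiliary condition on a series in `u⁻¹` and `v`: all coefficients are central in the double
Yangian, and only monomials `u^{-a} v^b` with `b < a` occur. -/
def Small (f : PowerSeries (PowerSeries (DYFree m n))) : Prop :=
  ∀ a b, proj m n (coeff₂ a b f) ∈ Subalgebra.center ℂ (DY m n) ∧ (a ≤ b → coeff₂ a b f = 0)

theorem small_shiftInv {e : DYFree m n} (he : proj m n e ∈ Subalgebra.center ℂ (DY m n))
    {f : PowerSeries ℂ} (hf : PowerSeries.coeff 0 f = 0) :
    Small (shiftInv f (PowerSeries.X - PowerSeries.C e)) := by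
  have hpow : ∀ j b, proj m n (PowerSeries.coeff b ((PowerSeries.X - PowerSeries.C e) ^ j)) ∈
      Subalgebra.center ℂ (DY m n) ∧
      (j < b → PowerSeries.coeff b ((PowerSeries.X - PowerSeries.C e) ^ j) = 0) := by
    intro j
    induction j with
    | zero =>
      intro b
      rw [pow_zero, PowerSeries.coeff_one]
      refine ⟨?_, fun h => if_neg (by omega)⟩
      split_ifs
      · rw [map_one]; exact one_mem _
      · rw [map_zero]; exact zero_mem _
    | succ j ih =>
      intro b
      rw [pow_succ, mul_sub, map_sub, PowerSeries.coeff_mul_C]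
      match b with
      | 0 =>
        rw [PowerSeries.coeff_zero_mul_X, zero_sub, map_neg, map_mul]
        exact ⟨neg_mem (mul_mem (ih 0).1 he), fun h => by omega⟩
      | b + 1 =>
        rw [PowerSeries.coeff_succ_mul_X, map_sub, map_mul]
        refine ⟨sub_mem (ih b).1 (mul_mem (ih (b + 1)).1 he), fun h => ?_⟩
        rw [(ih b).2 (by omega), (ih (b + 1)).2 (by omega), zero_mul, sub_zero]
  intro a b
  rw [coeff₂, shiftInv, PowerSeries.coeff_mk, map_sum]
  refine ⟨?_, fun hab => Finset.sum_eq_zero fun k hk => ?_⟩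
  · rw [map_sum]
    refine sum_mem fun k _ => ?_
    rw [PowerSeries.coeff_smul, map_smul]
    exact Subalgebra.smul_mem _ (hpow _ _).1 _
  · rw [PowerSeries.coeff_smul]
    rcases Nat.eq_zero_or_pos k with rfl | hk0
    · rw [hf, zero_mul, zero_smul]
    · rw [(hpow _ _).2 (by have := Finset.mem_range.1 hk; omega), smul_zero]

theorem Small.zero : Small (0 : PowerSeries (PowerSeries (DYFree m n))) := fun a b => by
  simp [coeff₂]

theorem Small.sub {f g : PowerSeries (PowerSeries (DYFree m n))} (hf : Small f) (hg : Small g) :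
    Small (f - g) := fun a b => by
  simp only [coeff₂, map_sub]
  refine ⟨sub_mem (hf a b).1 (hg a b).1, fun h => ?_⟩
  exact (congrArg₂ (· - ·) ((hf a b).2 h) ((hg a b).2 h)).trans (sub_zero 0)

theorem Small.mul_sign {f : PowerSeries (PowerSeries (DYFree m n))} (hf : Small f) (k : ℕ) :
    Small (f * (-1) ^ k) := by
  rcases neg_one_pow_eq_or (PowerSeries (PowerSeries (DYFree m n))) k with h | h
  · rwa [h, mul_one]
  · rw [h, mul_neg_one]
    simpa using Small.zero.sub hf

theorem small_RMixed {e : DYFree m n} (he : proj m n e ∈ Subalgebra.center ℂ (DY m n))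
    (i j k l : SIdx m n) : Small ((RMixed m n _ e - SMat.one :
      SMat m n (PowerSeries (PowerSeries (DYFree m n)))) i j k l) := by
  have h1 : shiftInv (gSeries ((m : ℂ) - n)) (PowerSeries.X - PowerSeries.C e) - 1 =
      shiftInv (gSeries ((m : ℂ) - n) - 1) (PowerSeries.X - PowerSeries.C e) := by
    ext1 d
    simp only [shiftInv, map_sub, PowerSeries.coeff_mk, sub_mul, sub_smul, Finset.sum_sub_distrib]
    congr 1
    rw [Finset.sum_eq_single 0]
    · rcases Nat.eq_zero_or_pos d with rfl | hd
      · simp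
      · rw [PowerSeries.coeff_one, if_neg hd.ne', Nat.choose_eq_zero_of_lt (by omega)]
        simp
    · intro k _ hk
      rw [PowerSeries.coeff_one, if_neg hk, zero_mul, zero_smul]
    · simp
  have h2 := small_shiftInv he (f := gSeries ((m : ℂ) - n) - 1)
    (by rw [map_sub, gSeries_constantCoeff]; simp)
  have h3 := small_shiftInv he (f := PowerSeries.X * gSeries ((m : ℂ) - n)) (by simp)
  rw [← h1] at h2
  have : (RMixed m n _ e - SMat.one :
      SMat m n (PowerSeries (PowerSeries (DYFree m n)))) i j k l =
      (if i = j ∧ k = l then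
        shiftInv (gSeries ((m : ℂ) - n)) (PowerSeries.X - PowerSeries.C e) - 1 else 0) -
      (if k = j ∧ l = i then
        shiftInv (PowerSeries.X * gSeries ((m : ℂ) - n)) (PowerSeries.X - PowerSeries.C e) *
          (-1) ^ par j else 0) := by
    simp only [RMixed, Rbar, Pi.sub_apply, SMat.scale, SMat.one, SMat.P]
    split_ifs <;> simp [sub_right_comm]
  rw [this]
  refine Small.sub ?_ ?_
  · split_ifs
    exacts [h2, Small.zero]
  · split_ifs
    exacts [h3.mul_sign _, Small.zero]

section Mem

variable {A : Type*} [Ring A]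

theorem coeff₂_inFst_mul_inSnd (f g : PowerSeries A) (a b : ℕ) :
    coeff₂ a b (inFst f * inSnd g) = PowerSeries.coeff a f * PowerSeries.coeff b g := by
  simp [coeff₂, inFst, inSnd, PowerSeries.coeff_mul_C, PowerSeries.coeff_C_mul]

theorem coeff₂_inSnd_mul_inFst (f g : PowerSeries A) (a b : ℕ) :
    coeff₂ a b (inSnd g * inFst f) = PowerSeries.coeff b g * PowerSeries.coeff a f := by
  simp [coeff₂, inFst, inSnd, PowerSeries.coeff_mul_C, PowerSeries.coeff_C_mul]

theorem coeff₂_sign (f : PowerSeries (PowerSeries A)) (a b k : ℕ) :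
    coeff₂ a b ((-1) ^ k * f) = (-1) ^ k * coeff₂ a b f := by
  rcases Nat.even_or_odd k with h | h <;> simp [h.neg_one_pow, coeff₂]

variable [Algebra ℂ A]

theorem coeff₂_mul_mem (M : Submodule ℂ A) (f g : PowerSeries (PowerSeries A)) (a b : ℕ)
    (H : ∀ a₁ a₂ b₁ b₂, a₁ + a₂ = a → b₁ + b₂ = b → coeff₂ a₁ b₁ f * coeff₂ a₂ b₂ g ∈ M) :
    coeff₂ a b (f * g) ∈ M := by
  rw [coeff₂, PowerSeries.coeff_mul, map_sum]
  refine sum_mem fun x hx => ?_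
  rw [PowerSeries.coeff_mul]
  refine sum_mem fun y hy => ?_
  exact H _ _ _ _ (Finset.HasAntidiagonal.mem_antidiagonal.1 hx) (Finset.HasAntidiagonal.mem_antidiagonal.1 hy)

theorem coeff₂_sign_mem (M : Submodule ℂ A) (f : PowerSeries (PowerSeries A)) (a b k : ℕ)
    (H : coeff₂ a b f ∈ M) : coeff₂ a b ((-1) ^ k * f) ∈ M := by
  rcases neg_one_pow_eq_or (PowerSeries (PowerSeries A)) k with h | h
  · rwa [h, one_mul]
  · rw [h, neg_one_mul]
    simp only [coeff₂, map_neg]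
    exact neg_mem H

theorem coeff₂_SMat_mul_mem (M : Submodule ℂ A) (X Y : SMat m n (PowerSeries (PowerSeries A)))
    (a b : ℕ) (H : ∀ i j k l i' j' k' l' a₁ a₂ b₁ b₂, a₁ + a₂ = a → b₁ + b₂ = b →
      coeff₂ a₁ b₁ (X i j k l) * coeff₂ a₂ b₂ (Y i' j' k' l') ∈ M) (i j k l : SIdx m n) :
    coeff₂ a b ((X ⊙ₛ Y) i j k l) ∈ M := by
  rw [SMat.mul, coeff₂, map_sum, map_sum]
  refine sum_mem fun p _ => ?_
  rw [map_sum, map_sum]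
  refine sum_mem fun q _ => coeff₂_sign_mem M _ a b _ ?_
  exact coeff₂_mul_mem M _ _ a b fun a₁ a₂ b₁ b₂ => H _ _ _ _ _ _ _ _ a₁ a₂ b₁ b₂

theorem coeff₂_SMat_mul₃_mem (M : Submodule ℂ A)
    (X Y Z : SMat m n (PowerSeries (PowerSeries A))) (a b : ℕ)
    (H : ∀ i j k l i' j' k' l' i'' j'' k'' l'' a₁ a₂ a₃ b₁ b₂ b₃,
      a₁ + a₂ + a₃ = a → b₁ + b₂ + b₃ = b →
      coeff₂ a₁ b₁ (X i j k l) * coeff₂ a₂ b₂ (Y i' j' k' l') *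
        coeff₂ a₃ b₃ (Z i'' j'' k'' l'') ∈ M) (i j k l : SIdx m n) :
    coeff₂ a b ((X ⊙ₛ Y ⊙ₛ Z) i j k l) ∈ M := by
  refine coeff₂_SMat_mul_mem M _ _ a b (fun i j k l i'' j'' k'' l'' a' a₃ b' b₃ ha hb => ?_) i j k l
  have := coeff₂_SMat_mul_mem (M.comap (LinearMap.mulRight ℂ (coeff₂ a₃ b₃ (Z i'' j'' k'' l''))))
    X Y a' b' (fun i j k l i' j' k' l' a₁ a₂ b₁ b₂ ha' hb' =>
      H i j k l i' j' k' l' i'' j'' k'' l'' a₁ a₂ a₃ b₁ b₂ b₃ (by omega) (by omega)) i j k l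
  exact this

end Mem

section SMatAlg

variable {S : Type*} [Ring S]

theorem SMat_add_mul (X Y Z : SMat m n S) : (X + Y) ⊙ₛ Z = X ⊙ₛ Z + Y ⊙ₛ Z := by
  funext i j k l
  simp only [SMat.mul, Pi.add_apply, add_mul, mul_add, Finset.sum_add_distrib]

theorem SMat_mul_add (X Y Z : SMat m n S) : X ⊙ₛ (Y + Z) = X ⊙ₛ Y + X ⊙ₛ Z := by
  funext i j k l
  simp only [SMat.mul, Pi.add_apply, mul_add, Finset.sum_add_distrib]

theorem SMat_one_mul (X : SMat m n S) : SMat.one ⊙ₛ X = X := by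
  funext i j k l
  rw [SMat.mul, Finset.sum_eq_single i, Finset.sum_eq_single k]
  · rw [Even.neg_one_pow]
    · simp [SMat.one]
    · exact ⟨(par i + par j) * (par k + par k + par i) + (par k + par l) * (par i + par k), by ring⟩
  · intro q _ hq
    simp [SMat.one, hq.symm]
  · simp
  · intro p _ hp
    simp [SMat.one, hp.symm]
  · simp

theorem SMat_mul_one (X : SMat m n S) : X ⊙ₛ SMat.one = X := by
  funext i j k l
  rw [SMat.mul, Finset.sum_eq_single j, Finset.sum_eq_single l]
  · rw [Even.neg_one_pow]
    · simp [SMat.one]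
    · exact ⟨par j * (par k + par l + (par i + par j + par k + par l)) +
        par l * (par i + par j + par k + par l), by ring⟩
  · intro q _ hq
    simp [SMat.one, hq]
  · simp
  · intro p _ hp
    simp [SMat.one, hp]
  · simp

theorem SMat_fst_mul_snd (x y : SIdx m n → SIdx m n → S) (i j k l : SIdx m n) :
    (SMat.fst x ⊙ₛ SMat.snd y) i j k l =
      (-1) ^ ((par k + par l) * (par i + par j) +
        (par i * par j + par j + (par k * par l + par l))) * (x i j * y k l) := by
  rw [SMat.mul, Finset.sum_eq_single j, Finset.sum_eq_single k]
  · simp only [SMat.fst, SMat.snd, if_true]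
    rcases neg_one_pow_eq_or S (par i * par j + par j) with h1 | h1 <;>
    rcases neg_one_pow_eq_or S (par k * par l + par l) with h2 | h2 <;>
    rw [pow_add _ ((par k + par l) * (par i + par j)), pow_add _ (par i * par j + par j), h1, h2] <;>
    rw [show (par j + par j) * (par k + par k + (par i + par j + par k + par k)) +
        (par k + par l) * (par i + par j + par k + par k) = 2 * (par j *
        (par k + par k + (par i + par j + par k + par k)) + (par k + par l) * par k) +
        (par k + par l) * (par i + par j) by ring, pow_add, pow_mul] <;> simp
  · intro q _ hq
    simp [SMat.fst, hq.symm]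
  · simp
  · intro p _ hp
    simp [SMat.snd, hp]
  · simp

theorem SMat_snd_mul_fst (x y : SIdx m n → SIdx m n → S) (i j k l : SIdx m n) :
    (SMat.snd y ⊙ₛ SMat.fst x) i j k l =
      (-1) ^ (par i * par j + par j + (par k * par l + par l)) * (y k l * x i j) := by
  rw [SMat.mul, Finset.sum_eq_single i, Finset.sum_eq_single l]
  · simp only [SMat.fst, SMat.snd, if_true]
    rcases neg_one_pow_eq_or S (par i * par j + par j) with h1 | h1 <;>
    rcases neg_one_pow_eq_or S (par k * par l + par l) with h2 | h2 <;>
    rw [pow_add _ (par i * par j + par j), h1, h2] <;>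
    rw [show (par i + par j) * (par k + par l + (par i + par i + par k + par l)) +
        (par l + par l) * (par i + par i + par k + par l) = 2 * ((par i + par j) *
        (par k + par l + par i) + par l * (par i + par i + par k + par l)) by ring,
        pow_mul] <;> simp
  · intro q _ hq
    simp [SMat.fst, hq]
  · simp
  · intro p _ hp
    simp [SMat.snd, hp.symm]
  · simp

end SMatAlg

/-- The coefficient of `u^{-r}` in `t_{ij}(u)`, in the double Yangian. -/
noncomputable def tCoeff (r : ℕ) (i j : SIdx m n) : DY m n :=
  proj m n (PowerSeries.coeff r (DYFree.t m n i j))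

/-- The coefficient of `u^s` in `t⁺_{ij}(u)`, in the double Yangian. -/
noncomputable def tPlusCoeff (s : ℕ) (i j : SIdx m n) : DY m n :=
  proj m n (PowerSeries.coeff s (DYFree.tPlus m n i j))

theorem tCoeff_zero (i j : SIdx m n) : tCoeff 0 i j = if i = j then 1 else 0 := by
  rw [tCoeff, DYFree.t, tSeries]
  split_ifs <;> simp

theorem tCoeff_succ (r : ℕ) (i j : SIdx m n) : tCoeff (r + 1) i j = tPos r i j := by
  rw [tCoeff, DYFree.t, tSeries, map_add, PowerSeries.coeff_succ_X_mul, PowerSeries.coeff_mk]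
  split_ifs <;> simp [PowerSeries.coeff_one, tPos]

theorem tPlusCoeff_eq (s : ℕ) (i j : SIdx m n) :
    tPlusCoeff s i j = (if s = 0 ∧ i = j then 1 else 0) - tNeg s i j := by
  rw [tPlusCoeff, DYFree.tPlus, tPlusSeries, map_sub, PowerSeries.coeff_mk]
  by_cases hs : s = 0 <;> by_cases hij : i = j <;> simp [hs, hij, PowerSeries.coeff_one, tNeg]

theorem coeff₂_fst (t : SIdx m n → SIdx m n → PowerSeries (DYFree m n)) (i j k l : SIdx m n)
    (a b : ℕ) : ∃ z : ℂ, (b ≠ 0 → z = 0) ∧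
      coeff₂ a b (SMat.fst (fun p q => inFst (t p q)) i j k l) = z • PowerSeries.coeff a (t i j) := by
  by_cases hk : k = l
  · by_cases hb : b = 0
    · rcases neg_one_pow_eq_or (PowerSeries (PowerSeries (DYFree m n)))
        (par i * par j + par j) with h | h
      · exact ⟨1, by simp [hb], by simp [SMat.fst, hk, hb, h, coeff₂, inFst]⟩
      · exact ⟨-1, by simp [hb], by simp [SMat.fst, hk, hb, h, coeff₂, inFst]⟩
    · refine ⟨0, by simp, ?_⟩
      rcases neg_one_pow_eq_or (PowerSeries (PowerSeries (DYFree m n)))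
        (par i * par j + par j) with h | h <;>
      simp [SMat.fst, hk, h, coeff₂, inFst, PowerSeries.coeff_C, hb]
  · exact ⟨0, by simp, by simp [SMat.fst, hk, coeff₂]⟩

theorem coeff₂_snd (t : SIdx m n → SIdx m n → PowerSeries (DYFree m n)) (i j k l : SIdx m n)
    (a b : ℕ) : ∃ z : ℂ, (a ≠ 0 → z = 0) ∧
      coeff₂ a b (SMat.snd (fun p q => inSnd (t p q)) i j k l) = z • PowerSeries.coeff b (t k l) := by
  by_cases hk : i = j
  · by_cases ha : a = 0
    · rcases neg_one_pow_eq_or (PowerSeries (PowerSeries (DYFree m n)))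
        (par k * par l + par l) with h | h
      · exact ⟨1, by simp [ha], by simp [SMat.snd, hk, ha, h, coeff₂, inSnd]⟩
      · exact ⟨-1, by simp [ha], by simp [SMat.snd, hk, ha, h, coeff₂, inSnd]⟩
    · refine ⟨0, by simp, ?_⟩
      rcases neg_one_pow_eq_or (PowerSeries (PowerSeries (DYFree m n)))
        (par k * par l + par l) with h | h <;>
      simp [SMat.snd, hk, h, coeff₂, inSnd, PowerSeries.coeff_C, ha]
  · exact ⟨0, by simp, by simp [SMat.snd, hk, coeff₂]⟩

/-- The exchange of `t_{ij}^{(r)}` and `t_{kl}^{(-s-1)}`, up to terms which are controlled by the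
subspace `M`. -/
theorem exchange (M : Submodule ℂ (DY m n)) (r s : ℕ)
    (H₁ : ∀ a b i j k l z, b < a → a ≤ r → b ≤ s → z ∈ Subalgebra.center ℂ (DY m n) →
      z * tCoeff (r - a) i j * tPlusCoeff (s - b) k l ∈ M)
    (H₂ : ∀ a b i j k l z, b < a → a ≤ r → b ≤ s → z ∈ Subalgebra.center ℂ (DY m n) →
      tPlusCoeff (s - b) k l * tCoeff (r - a) i j * z ∈ M)
    (i j k l : SIdx m n) (H₃ : tNeg s k l * tCoeff r i j ∈ M) :
    tCoeff r i j * tNeg s k l ∈ M := by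
  set e : DYFree m n := (1 / 2 : ℂ) • DYFree.c m n with he_def
  have he : proj m n e ∈ Subalgebra.center ℂ (DY m n) := by
    rw [he_def, map_smul]; exact Subalgebra.smul_mem _ c_mem_center _
  have he' : proj m n (-e) ∈ Subalgebra.center ℂ (DY m n) := by
    rw [map_neg]; exact neg_mem he
  set T₁ : SMat m n (PowerSeries (PowerSeries (DYFree m n))) :=
    SMat.fst fun p q => inFst (DYFree.t m n p q) with hT₁
  set T₂ : SMat m n (PowerSeries (PowerSeries (DYFree m n))) :=
    SMat.snd fun p q => inSnd (DYFree.tPlus m n p q) with hT₂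
  have hrel := RingQuot.mkAlgHom_rel ℂ (DYRel.mixed (m := m) (n := n) i j k l r s)
  change proj m n (coeff₂ r s ((RMixed m n _ e ⊙ₛ T₁ ⊙ₛ T₂) i j k l)) =
    proj m n (coeff₂ r s ((T₂ ⊙ₛ T₁ ⊙ₛ RMixed m n _ (-e)) i j k l)) at hrel
  set X := RMixed m n (DYFree m n) e - SMat.one with hX
  set Y := RMixed m n (DYFree m n) (-e) - SMat.one with hY
  rw [show RMixed m n (DYFree m n) e = SMat.one + X by rw [hX]; abel,
    show RMixed m n (DYFree m n) (-e) = SMat.one + Y by rw [hY]; abel,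
    SMat_add_mul, SMat_add_mul, SMat_one_mul, SMat_mul_add, SMat_mul_one, Pi.add_apply,
    Pi.add_apply, Pi.add_apply, Pi.add_apply, Pi.add_apply, Pi.add_apply, Pi.add_apply,
    Pi.add_apply] at hrel
  have h1 : coeff₂ r s ((X ⊙ₛ T₁ ⊙ₛ T₂) i j k l) ∈ M.comap (proj m n).toLinearMap := by
    refine coeff₂_SMat_mul₃_mem _ _ _ _ r s ?_ i j k l
    intro i j k l i' j' k' l' i'' j'' k'' l'' a₁ a₂ a₃ b₁ b₂ b₃ ha hb
    obtain ⟨z₁, hz₁, e₁⟩ := coeff₂_fst (DYFree.t m n) i' j' k' l' a₂ b₂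
    obtain ⟨z₂, hz₂, e₂⟩ := coeff₂_snd (DYFree.tPlus m n) i'' j'' k'' l'' a₃ b₃
    rw [hT₁, hT₂, e₁, e₂]
    by_cases h2 : b₂ = 0
    · by_cases h3 : a₃ = 0
      · have hs := small_RMixed he i j k l a₁ b₁
        rw [← hX] at hs
        by_cases hab : a₁ ≤ b₁
        · rw [hs.2 hab]; simp
        · have := H₁ a₁ b₁ i' j' k'' l'' _ (by omega) (by omega) (by omega) hs.1
          rw [Submodule.mem_comap]
          obtain rfl : a₂ = r - a₁ := by omega
          obtain rfl : b₃ = s - b₁ := by omega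
          rw [mul_smul_comm, mul_smul_comm, smul_mul_assoc, map_smul, map_smul]
          refine M.smul_mem _ (M.smul_mem _ ?_)
          simpa [tCoeff, tPlusCoeff] using this
      · rw [hz₂ h3]; simp
    · rw [hz₁ h2]; simp
  have h2 : coeff₂ r s ((T₂ ⊙ₛ T₁ ⊙ₛ Y) i j k l) ∈ M.comap (proj m n).toLinearMap := by
    refine coeff₂_SMat_mul₃_mem _ _ _ _ r s ?_ i j k l
    intro i j k l i' j' k' l' i'' j'' k'' l'' a₁ a₂ a₃ b₁ b₂ b₃ ha hb
    obtain ⟨z₁, hz₁, e₁⟩ := coeff₂_snd (DYFree.tPlus m n) i j k l a₁ b₁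
    obtain ⟨z₂, hz₂, e₂⟩ := coeff₂_fst (DYFree.t m n) i' j' k' l' a₂ b₂
    rw [hT₁, hT₂, e₁, e₂]
    by_cases h2 : b₂ = 0
    · by_cases h3 : a₁ = 0
      · have hs := small_RMixed he' i'' j'' k'' l'' a₃ b₃
        rw [← hY] at hs
        by_cases hab : a₃ ≤ b₃
        · rw [hs.2 hab]; simp
        · have := H₂ a₃ b₃ i' j' k l _ (by omega) (by omega) (by omega) hs.1
          rw [Submodule.mem_comap]
          obtain rfl : a₂ = r - a₃ := by omega
          obtain rfl : b₁ = s - b₃ := by omega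
          rw [mul_smul_comm, smul_mul_assoc, smul_mul_assoc, smul_mul_assoc, map_smul, map_smul]
          refine M.smul_mem _ (M.smul_mem _ ?_)
          simpa [tCoeff, tPlusCoeff] using this
      · rw [hz₁ h3]; simp
    · rw [hz₂ h2]; simp
  rw [hT₁, hT₂, SMat_fst_mul_snd, SMat_snd_mul_fst, ← hT₁, ← hT₂] at hrel
  simp only [coeff₂, map_add] at hrel
  simp only [← coeff₂.eq_1] at hrel
  rw [coeff₂_sign, coeff₂_sign, coeff₂_inFst_mul_inSnd, coeff₂_inSnd_mul_inFst, map_mul, map_mul,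
    map_mul, map_mul] at hrel
  change _ * (tCoeff r i j * tPlusCoeff s k l) + _ =
    _ * (tPlusCoeff s k l * tCoeff r i j) + _ at hrel
  rw [Submodule.mem_comap] at h1 h2
  change proj m n _ ∈ M at h1
  change proj m n _ ∈ M at h2
  rw [tPlusCoeff_eq, pow_add, map_mul] at hrel
  set d := par i * par j + par j + (par k * par l + par l)
  simp only [map_pow, map_neg, map_one] at hrel
  have hδ : (-1 : DY m n) ^ ((par k + par l) * (par i + par j)) *
      (tCoeff r i j * if s = 0 ∧ k = l then 1 else 0) =
      (if s = 0 ∧ k = l then 1 else 0) * tCoeff r i j := by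
    split_ifs with h
    · rw [Even.neg_one_pow ⟨par k * (par i + par j), by rw [h.2]; ring⟩]
      simp
    · simp
  rcases neg_one_pow_eq_or (DY m n) ((par k + par l) * (par i + par j)) with h | h <;>
  rcases neg_one_pow_eq_or (DY m n) d with h' | h' <;>
  rw [h, h'] at hrel <;> rw [h] at hδ <;>
  simp only [one_mul, neg_mul, mul_sub, sub_mul, mul_one, neg_neg, mul_neg] at hrel hδ
  · rw [hδ] at hrel
    convert M.sub_mem (M.add_mem H₃ h1) h2 using 1
    rw [← sub_eq_zero] at hrel ⊢
    rw [← neg_eq_zero, ← hrel]; abel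
  · rw [hδ] at hrel
    convert M.sub_mem (M.add_mem H₃ h2) h1 using 1
    rw [← sub_eq_zero] at hrel ⊢
    rw [← hrel]; abel
  · rw [← hδ] at hrel
    convert M.neg_mem (M.sub_mem (M.add_mem H₃ h1) h2) using 1
    rw [← sub_eq_zero] at hrel ⊢
    rw [← hrel]; abel
  · rw [← hδ] at hrel
    convert M.neg_mem (M.sub_mem (M.add_mem H₃ h2) h1) using 1
    rw [← sub_eq_zero] at hrel ⊢
    rw [← neg_eq_zero, ← hrel]; abel

/-- Left multiplication by a coefficient of `u^{-r}` lowers the filtration degree by at most `r`. -/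
theorem tCoeff_mul_nbhd (r : ℕ) : ∀ (i j : SIdx m n) (p q : ℕ) (x : DY m n), p + r ≤ q →
    x ∈ nbhd m n q → tCoeff r i j * x ∈ nbhd m n p := by
  induction r using Nat.strong_induction_on with
  | _ r ih =>
  intro i j p q x hpq hx
  have hP : ∀ (s : ℕ) (k l : SIdx m n) (p : ℕ) (y : DY m n), y ∈ nbhd m n p →
      (if s = 0 ∧ k = l then 1 else 0) * y ∈ nbhd m n (if s = 0 then p else p + s + 1) := by
    intro s k l p y hy
    by_cases hs : s = 0
    · by_cases hkl : k = l
      · simpa [hs, hkl] using hy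
      · simp [hs, hkl]
    · simp [hs]
  have hT : ∀ (s : ℕ) (k l : SIdx m n) (p : ℕ) (y : DY m n), y ∈ nbhd m n p →
      tPlusCoeff s k l * y ∈ nbhd m n (if s = 0 then p else p + s + 1) := by
    intro s k l p y hy
    rw [tPlusCoeff_eq, sub_mul]
    refine sub_mem (hP s k l p y hy) (nbhd_anti ?_ (tNeg_mul_nbhd s k l hy))
    split_ifs <;> omega
  refine mul_nbhd_of (fun L hL => ?_) hx
  have key : ∀ (L : List (ℕ × SIdx m n × SIdx m n)) (p : ℕ),
      p + r ≤ (L.map fun s => s.1 + 1).sum → ∀ i j,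
      tCoeff r i j * (L.map fun s => tNeg s.1 s.2.1 s.2.2).prod ∈ nbhd m n p := by
    intro L
    induction L with
    | nil =>
      intro p hp i j
      obtain rfl : p = 0 := by simp at hp; omega
      rw [nbhd_zero]; exact Submodule.mem_top
    | cons g L ihL =>
      obtain ⟨s, k, l⟩ := g
      intro p hp i j
      rw [List.map_cons, List.sum_cons] at hp
      rw [List.map_cons, List.prod_cons, ← mul_assoc]
      set w := (L.map fun s => s.1 + 1).sum with hw
      set y := (L.map fun s => (tNeg s.1 s.2.1 s.2.2 : DY m n)).prod with hy
      have hyw : y ∈ nbhd m n w := prod_mem_nbhd L le_rfl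
      change tCoeff r i j * tNeg s k l * y ∈ nbhd m n p
      have hp' : p + r ≤ s + 1 + w := hp
      have := exchange ((nbhd m n p).comap (LinearMap.mulRight ℂ y)) r s ?_ ?_ i j k l ?_
      · exact this
      · intro a b i j k l z hba har hbs hz
        change z * tCoeff (r - a) i j * tPlusCoeff (s - b) k l * y ∈ nbhd m n p
        rw [mul_assoc, mul_assoc]
        refine central_mul_nbhd hz (ih (r - a) (by omega) i j p _ _ ?_ (hT (s - b) k l w y hyw))
        split_ifs <;> omega
      · intro a b i j k l z hba har hbs hz
        change tPlusCoeff (s - b) k l * tCoeff (r - a) i j * z * y ∈ nbhd m n p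
        rw [mul_assoc, mul_assoc]
        by_cases hwr : r - a ≤ w
        · refine nbhd_anti ?_ (hT (s - b) k l (w - (r - a)) _
            (ih (r - a) (by omega) i j (w - (r - a)) w _ (by omega) (central_mul_nbhd hz hyw)))
          split_ifs <;> omega
        · have h0 : tCoeff (r - a) i j * (z * y) ∈ nbhd m n 0 := by
            rw [nbhd_zero]; exact Submodule.mem_top
          refine nbhd_anti ?_ (hT (s - b) k l 0 _ h0)
          split_ifs <;> omega
      · change tNeg s k l * tCoeff r i j * y ∈ nbhd m n p
        rw [mul_assoc]
        by_cases hwr : r ≤ w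
        · exact nbhd_anti (by omega) (tNeg_mul_nbhd s k l (ihL (w - r) (by omega) i j))
        · have h0 : tCoeff r i j * y ∈ nbhd m n 0 := by
            rw [nbhd_zero]; exact Submodule.mem_top
          exact nbhd_anti (by omega) (tNeg_mul_nbhd s k l h0)
  exact key L p (hpq.trans hL) i j

theorem exists_mul_nbhd (x : DY m n) (p : ℕ) : ∃ q, ∀ y ∈ nbhd m n q, x * y ∈ nbhd m n p := by
  obtain ⟨x, rfl⟩ := proj_surjective x
  induction x using FreeAlgebra.induction generalizing p with
  | grade0 z =>
    refine ⟨p, fun y hy => ?_⟩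
    rw [AlgHom.commutes, ← Algebra.smul_def]
    exact Submodule.smul_mem _ _ hy
  | grade1 g =>
    match g with
    | .c => exact ⟨p, fun y hy => central_mul_nbhd c_mem_center hy⟩
    | .pos r i j =>
      refine ⟨p + (r + 1), fun y hy => ?_⟩
      have := tCoeff_mul_nbhd (r + 1) i j p _ y le_rfl hy
      rwa [tCoeff_succ] at this
    | .neg r i j => exact ⟨p, fun y hy => nbhd_anti (by omega) (tNeg_mul_nbhd r i j hy)⟩
  | mul a b ha hb =>
    obtain ⟨q, hq⟩ := ha p
    obtain ⟨q', hq'⟩ := hb q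
    refine ⟨q', fun y hy => ?_⟩
    rw [map_mul, mul_assoc]
    exact hq _ (hq' y hy)
  | add a b ha hb =>
    obtain ⟨q, hq⟩ := ha p
    obtain ⟨q', hq'⟩ := hb p
    refine ⟨max q q', fun y hy => ?_⟩
    rw [map_add, add_mul]
    exact add_mem (hq _ (nbhd_anti (le_max_left _ _) hy)) (hq' _ (nbhd_anti (le_max_right _ _) hy))

variable (m n) in
theorem ringSubgroupsBasis : RingSubgroupsBasis fun p => (nbhd m n p).toAddSubgroup where
  inter p q := ⟨max p q, le_inf (nbhd_anti (le_max_left _ _)) (nbhd_anti (le_max_right _ _))⟩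
  mul p := ⟨p, by
    rintro _ ⟨x, hx, y, _, rfl⟩
    exact nbhd_mul hx y⟩
  leftMul x p := exists_mul_nbhd x p
  rightMul x p := ⟨p, fun y hy => nbhd_mul hy x⟩

/-- The topology on the double Yangian in which the right ideals generated by the terms of the
filtration of the dual Yangian form a basis of neighbourhoods of zero. -/
noncomputable instance : TopologicalSpace (DY m n) := (ringSubgroupsBasis m n).topology

instance : IsTopologicalRing (DY m n) :=
  (ringSubgroupsBasis m n).toRingFilterBasis.isTopologicalRing

noncomputable instance : UniformSpace (DY m n) := IsTopologicalAddGroup.rightUniformSpace (DY m n)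

instance : IsUniformAddGroup (DY m n) := isUniformAddGroup_of_addCommGroup

instance : UniformContinuousConstSMul ℂ (DY m n) where
  uniformContinuous_const_smul z := by
    have : (fun x : DY m n => z • x) = fun x => algebraMap ℂ (DY m n) z * x := by
      funext x; exact Algebra.smul_def z x
    rw [this]
    exact uniformContinuous_addMonoidHom_of_continuous
      (f := AddMonoidHom.mulLeft (algebraMap ℂ (DY m n) z)) (continuous_const.mul continuous_id)

end DY

/-! ## The extended double Yangian -/

/-- The completion of the double Yangian. -/
abbrev DYHat (m n : ℕ) : Type := UniformSpace.Completion (DY m n)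

namespace DYHat

variable (m n : ℕ)

/-- The extended dual Yangian: the completion of the subalgebra generated by all `t_{ij}^{(-r)}`,
`r ≥ 1`, realized as its closure in the completion of the double Yangian. -/
noncomputable def extDual : Subalgebra ℂ (DYHat m n) :=
  (Algebra.adjoin ℂ {x | ∃ r i j, x = ((DY.tNeg r i j : DY m n) : DYHat m n)}).topologicalClosure

/-- The extended double Yangian: the subalgebra of the completion of the double Yangian generated
by the extended dual Yangian, the central element `C` and the elements `t_{ij}^{(r)}`, `r ≥ 1`. By
the defining relations it consists of all finite `ℂ[C]`-linear combinations of products `x y` with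
`x` in the extended dual Yangian and `y` in the Yangian. -/
noncomputable def extDY : Subalgebra ℂ (DYHat m n) :=
  Algebra.adjoin ℂ ((extDual m n : Set (DYHat m n)) ∪ {((DY.c m n : DY m n) : DYHat m n)} ∪
    {x | ∃ r i j, x = ((DY.tPos r i j : DY m n) : DYHat m n)})

variable {m n}

/-- `t_{ij}^{(-r-1)}` as an element of the extended dual Yangian. -/
noncomputable def tNeg (r : ℕ) (i j : SIdx m n) : extDual m n :=
  ⟨((DY.tNeg r i j : DY m n) : DYHat m n),
    Subalgebra.le_topologicalClosure _ (Algebra.subset_adjoin ⟨r, i, j, rfl⟩)⟩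

variable (m n) in
/-- The central element `C` of the extended double Yangian. -/
noncomputable def c : extDY m n :=
  ⟨((DY.c m n : DY m n) : DYHat m n), Algebra.subset_adjoin (Or.inl (Or.inr rfl))⟩

/-- `t_{ij}^{(r+1)}` as an element of the extended double Yangian. -/
noncomputable def tPos (r : ℕ) (i j : SIdx m n) : extDY m n :=
  ⟨((DY.tPos r i j : DY m n) : DYHat m n), Algebra.subset_adjoin (Or.inr ⟨r, i, j, rfl⟩)⟩

variable (m n) in
/-- The inclusion of the extended dual Yangian into the extended double Yangian. -/
noncomputable def incl : extDual m n →ₐ[ℂ] extDY m n :=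
  Subalgebra.inclusion fun _ hx => Algebra.subset_adjoin (Or.inl (Or.inl hx))

/-! ### The quantum contraction -/

/-- The entries `t⁺_{ij}(u)` of `T⁺(u)`, with coefficients in the extended dual Yangian. -/
noncomputable def tPlus (i j : SIdx m n) : PowerSeries (extDual m n) := tPlusSeries tNeg i j

/-- `h(u) = f(u + a)`: the coefficient of `u^k` in `h` is the convergent sum
`∑_r binom(r, k) a^{r-k} f_r`. -/
def IsShift (a : ℂ) (f h : PowerSeries (extDual m n)) : Prop :=
  ∀ k, HasSum (fun r : ℕ => ((r.choose k : ℂ) * a ^ (r - k)) • PowerSeries.coeff r f)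
    (PowerSeries.coeff k h)

/-- `z(u)` satisfies `P^{τ₂} T₁⁺(u+m-n) (T₂⁺(u)⁻¹)^τ = P^{τ₂} ⊗ z(u)`. Here `W` is the matrix of
entries of `T⁺(u+m-n)` and `Y = T₂⁺(u)⁻¹`; that both exist is part of the condition. -/
def IsQuantumContraction (z : PowerSeries (extDual m n)) : Prop :=
  ∃ (W : SIdx m n → SIdx m n → PowerSeries (extDual m n))
    (Y : SMat m n (PowerSeries (extDual m n))),
    (∀ i j, IsShift ((m : ℂ) - n) (tPlus i j) (W i j)) ∧
    SMat.snd tPlus ⊙ₛ Y = SMat.one ∧ Y ⊙ₛ SMat.snd tPlus = SMat.one ∧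
    SMat.tau₂ SMat.P ⊙ₛ SMat.fst W ⊙ₛ SMat.tau₂ Y = fun i j k l => SMat.tau₂ SMat.P i j k l * z

/-! ### The extended vacuum module -/

variable (m n)

/-- The left ideal generated by `C - κ · 1` and all `t_{ij}^{(r)}`, `r ≥ 1`. -/
noncomputable def vacuumIdeal (κ : ℂ) : Ideal (extDY m n) :=
  Ideal.span ({c m n - algebraMap ℂ (extDY m n) κ} ∪ {x | ∃ r i j, x = tPos r i j})

/-- The extended vacuum module at the level `κ`. -/
def VacuumModule (κ : ℂ) : Type := extDY m n ⧸ vacuumIdeal m n κ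

noncomputable instance (κ : ℂ) : AddCommGroup (VacuumModule m n κ) :=
  Submodule.Quotient.addCommGroup (vacuumIdeal m n κ)

noncomputable instance (κ : ℂ) : Module (extDY m n) (VacuumModule m n κ) :=
  Submodule.Quotient.module (vacuumIdeal m n κ)

noncomputable instance (κ : ℂ) : Module ℂ (VacuumModule m n κ) :=
  Module.compHom (VacuumModule m n κ) (algebraMap ℂ (extDY m n))

/-- The image of the unit in the extended vacuum module. -/
noncomputable def vacuum (κ : ℂ) : VacuumModule m n κ :=
  Submodule.Quotient.mk (p := vacuumIdeal m n κ) 1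

/-- The subspace of invariants of the extended vacuum module. -/
noncomputable def invariants (κ : ℂ) : Submodule ℂ (VacuumModule m n κ) where
  carrier := {v | ∀ (r : ℕ) (i j : SIdx m n), tPos r i j • v = 0}
  zero_mem' r i j := smul_zero _
  add_mem' hv hw r i j := by rw [smul_add, hv r i j, hw r i j, add_zero]
  smul_mem' z v hv r i j := by
    have h : z • v = algebraMap ℂ (extDY m n) z • v := rfl
    rw [h, smul_smul, ← Algebra.commutes z (tPos r i j), ← smul_smul, hv r i j, smul_zero]

end DYHat

/-! ## Super matrices as ordinary matrices -/

section Twist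

variable {m n : ℕ} {S : Type*} [Ring S]

/-! Rescaling the entries of a super matrix by suitable signs (`SMat.toMat`) turns the graded
product into the ordinary matrix product over an ungraded ring. Write Q = `QMat` for the image of
P^{τ₂}, and N = m - n. Q has rank one and Q² = NQ, because N is the superdimension of ℂ^{m|n}.

Existence of z⁺ (`SMat.exists_contraction`): at u = v + N the dual relation reads (N - P) T₁⁺(v+N)
T₂⁺(v) = T₂⁺(v) T₁⁺(v+N) (N - P). Multiplying by T₂⁺(v)⁻¹ on both sides and transposing the second
factor gives (N - Q) S T₁⁺ = T₁⁺ S (N - Q), where S is the transposed inverse. Since Q (N - Q) = 0,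
it follows that N Q T₁⁺ S = Q T₁⁺ S Q. The right side is a scalar times Q because Q has rank one,
and N ≠ 0 can be divided out. The scalar is unique because Q has an entry ±1.

Invariance: the coefficients of z⁺ commute with all coefficients of T(u), so t z⁺ 𝟏 = z⁺ t 𝟏 = 0. To
see the commutation (`mul_contraction_comm`, `SMat.contraction_comm`), T(u) is moved past T⁺(v+N) by
the shifted mixed relation, and past S by the transposed unshifted one. Unitarity, (1 + xP)(1 - xP)
= 1 - x², inverts the first R-matrix. Crossing, (1 - Q/w)⁻¹ = 1 + Q/(w - N), inverts the second. On
three tensor factors Q₁₂ P₀₁ = Q₁₂ Q₀₂, so next to Q₁₂ the R-matrices cancel in pairs. The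
functional equation of g makes the remaining scalar factors agree. The level enters only through the
central element C in the arguments of the R-matrices, so it plays no role.

Convergence: the shift u ↦ u + N and the inverse of T⁺(u) require the completion. The coefficient of
u^r in T⁺(u) has filtration degree at least r, and the nonconstant part of the matrix has positive
degree, so the series needed converge (`DYHat.exists_shift`, `DYHat.exists_inverse`). Relations are
carried to shifted arguments by rules for `HasShift`: multiplication by a polynomial in the shifted
variable becomes multiplication by the shifted polynomial, and limits are unique in a Hausdorff
ring. -/

theorem neg_one_pow_congr_of_even_add {a b : ℕ} (h : Even (a + b)) :
    (-1 : S) ^ a = (-1) ^ b := by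
  rcases Nat.even_or_odd b with hb | hb
  · rw [hb.neg_one_pow, ((Nat.even_add.1 h).2 hb).neg_one_pow]
  · rw [hb.neg_one_pow]
    have : Odd a := by
      rw [← Nat.not_even_iff_odd] at hb ⊢
      exact fun ha => hb ((Nat.even_add.1 h).1 ha)
    exact this.neg_one_pow

theorem neg_one_pow_mul_comm (a : ℕ) (x : S) : x * (-1) ^ a = (-1) ^ a * x :=
  ((Commute.neg_one_left x).pow_left a).eq.symm

theorem neg_one_pow_left_comm (a : ℕ) (x y : S) : x * ((-1) ^ a * y) = (-1) ^ a * (x * y) := by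
  rw [← mul_assoc, neg_one_pow_mul_comm, mul_assoc]

/-- A sign in the middle of a product moves to the front. -/
theorem sign_mul_sign_mul (a b : ℕ) (x y : S) :
    (-1) ^ a * x * ((-1) ^ b * y) = (-1) ^ (a + b) * (x * y) := by
  rw [pow_add, mul_assoc, ← mul_assoc x, neg_one_pow_mul_comm b x]
  simp only [mul_assoc]

theorem neg_one_pow_mul_self (a : ℕ) : (-1 : S) ^ a * (-1) ^ a = 1 := by
  rw [← pow_add, Even.neg_one_pow ⟨a, rfl⟩]

namespace SMat

/-- The ordinary matrix which corresponds to a super matrix. -/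
def toMat (X : SMat m n S) : Matrix (SIdx m n × SIdx m n) (SIdx m n × SIdx m n) S :=
  Matrix.of fun a b => (-1) ^ (par a.1 * par b.1 + par b.1 + par a.2 * par b.2 + par b.2 +
    (par a.2 + par b.2) * par a.1) * X a.1 b.1 a.2 b.2

/-- Each entry is only multiplied by a sign, and signs square to one. Identities of super matrices
can therefore be proved after applying `toMat`. -/
theorem toMat_injective : Function.Injective (toMat : SMat m n S → _) := by
  intro X Y h
  funext i j k l
  have := congrFun (congrFun h (i, k)) (j, l)
  simp only [toMat, Matrix.of_apply] at this
  have h2 := congrArg (fun x => (-1 : S) ^ (par i * par j + par j + par k * par l + par l +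
    (par k + par l) * par i) * x) this
  simpa only [← mul_assoc, neg_one_pow_mul_self, one_mul] using h2

/-- The sign in `toMat` is chosen to absorb the sign rule of `SMat.mul`. That rule depends only on
the parities of the indices, so `S` needs no grading. -/
theorem toMat_mul (X Y : SMat m n S) : toMat (X ⊙ₛ Y) = toMat X * toMat Y := by
  ext ⟨i, k⟩ ⟨j, l⟩
  simp only [toMat, Matrix.of_apply, Matrix.mul_apply, SMat.mul, Fintype.sum_prod_type,
    Finset.mul_sum]
  refine Finset.sum_congr rfl fun p _ => Finset.sum_congr rfl fun q _ => ?_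
  rw [sign_mul_sign_mul, ← mul_assoc, ← pow_add]
  congr 1
  refine neg_one_pow_congr_of_even_add ?_
  -- Evenness of the exponent becomes a propositional identity in the parities of the indices. All
  -- later sign checks follow this pattern.
  simp only [Nat.even_add, Nat.even_mul]
  grind

theorem toMat_one : toMat (one : SMat m n S) = 1 := by
  ext ⟨i, k⟩ ⟨j, l⟩
  simp only [toMat, Matrix.of_apply, one, Matrix.one_apply, Prod.mk.injEq]
  split_ifs with h
  · obtain ⟨rfl, rfl⟩ := h
    rw [mul_one, Even.neg_one_pow]
    simp only [Nat.even_add, Nat.even_mul]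
    grind
  · simp

theorem toMat_sub (X Y : SMat m n S) : toMat (X - Y) = toMat X - toMat Y := by
  ext a b
  simp [toMat, mul_sub]

/-- A matrix acting on the first tensor factor. -/
def fstMat (t : SIdx m n → SIdx m n → S) :
    Matrix (SIdx m n × SIdx m n) (SIdx m n × SIdx m n) S :=
  Matrix.of fun a b => if a.2 = b.2 then t a.1 b.1 else 0

/-- A matrix acting on the second tensor factor. -/
def sndMat (t : SIdx m n → SIdx m n → S) :
    Matrix (SIdx m n × SIdx m n) (SIdx m n × SIdx m n) S :=
  Matrix.of fun a b => if a.1 = b.1 then (-1) ^ (par a.1 * (par a.2 + par b.2)) * t a.2 b.2 else 0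

variable (m n S) in
/-- The super permutation. -/
def PMat : Matrix (SIdx m n × SIdx m n) (SIdx m n × SIdx m n) S :=
  Matrix.of fun a b => if a.1 = b.2 ∧ a.2 = b.1 then (-1) ^ (par a.1 * par a.2) else 0

variable (m n S) in
/-- The partial transpose of the super permutation. -/
def QMat : Matrix (SIdx m n × SIdx m n) (SIdx m n × SIdx m n) S :=
  Matrix.of fun a b => if a.1 = a.2 ∧ b.1 = b.2 then (-1) ^ par a.1 else 0

/-- The partial super transposition in the second factor. -/
def transposeMat (X : Matrix (SIdx m n × SIdx m n) (SIdx m n × SIdx m n) S) :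
    Matrix (SIdx m n × SIdx m n) (SIdx m n × SIdx m n) S :=
  Matrix.of fun a b => (-1) ^ (par a.2 * par b.2 + par a.2) * X (a.1, b.2) (b.1, a.2)

/-- The super transpose of a single matrix. -/
def superTranspose (t : SIdx m n → SIdx m n → S) (i j : SIdx m n) : S :=
  (-1) ^ (par i * par j + par i) * t j i

theorem toMat_fst (t : SIdx m n → SIdx m n → S) : toMat (fst t) = fstMat t := by
  ext ⟨i, k⟩ ⟨j, l⟩
  simp only [toMat, Matrix.of_apply, fst, fstMat]
  split_ifs with h
  · subst h
    rw [← mul_assoc, ← pow_add, Even.neg_one_pow, one_mul]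
    simp only [Nat.even_add, Nat.even_mul]
    grind
  · simp

theorem toMat_snd (t : SIdx m n → SIdx m n → S) : toMat (snd t) = sndMat t := by
  ext ⟨i, k⟩ ⟨j, l⟩
  simp only [toMat, Matrix.of_apply, snd, sndMat]
  split_ifs with h
  · subst h
    rw [← mul_assoc, ← pow_add]
    congr 1
    refine neg_one_pow_congr_of_even_add ?_
    simp only [Nat.even_add, Nat.even_mul]
    grind
  · simp

theorem toMat_P : toMat (P : SMat m n S) = PMat m n S := by
  ext ⟨i, k⟩ ⟨j, l⟩
  simp only [toMat, Matrix.of_apply, P, PMat]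
  by_cases h : k = j ∧ l = i
  · obtain ⟨rfl, rfl⟩ := h
    rw [if_pos ⟨rfl, rfl⟩, if_pos ⟨rfl, rfl⟩, ← pow_add]
    refine neg_one_pow_congr_of_even_add ?_
    simp only [Nat.even_add, Nat.even_mul]
    grind
  · rw [if_neg h, if_neg (by tauto), mul_zero]

theorem toMat_tau₂ (X : SMat m n S) : toMat (tau₂ X) = transposeMat (toMat X) := by
  ext ⟨i, k⟩ ⟨j, l⟩
  simp only [toMat, Matrix.of_apply, tau₂, transposeMat, ← mul_assoc, ← pow_add]
  congr 1
  refine neg_one_pow_congr_of_even_add ?_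
  simp only [Nat.even_add, Nat.even_mul]
  grind

theorem toMat_scale (s : S) (hs : ∀ x : S, s * x = x * s) (X : SMat m n S) :
    toMat (scale s X) = Matrix.scalar _ s * toMat X := by
  ext a b
  simp only [toMat, Matrix.of_apply, scale, Matrix.scalar_apply, Matrix.diagonal_mul, ← mul_assoc,
    hs]

theorem transposeMat_PMat : transposeMat (PMat m n S) = QMat m n S := by
  ext ⟨i, k⟩ ⟨j, l⟩
  simp only [transposeMat, Matrix.of_apply, PMat, QMat]
  by_cases h : i = k ∧ j = l
  · obtain ⟨rfl, rfl⟩ := h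
    rw [if_pos ⟨rfl, rfl⟩, if_pos ⟨rfl, rfl⟩, ← pow_add]
    refine neg_one_pow_congr_of_even_add ?_
    simp only [Nat.even_add, Nat.even_mul]
    grind
  · rw [if_neg h, if_neg (by tauto), mul_zero]

theorem transposeMat_sndMat (t : SIdx m n → SIdx m n → S) :
    transposeMat (sndMat t) = sndMat (superTranspose t) := by
  ext ⟨i, k⟩ ⟨j, l⟩
  simp only [transposeMat, Matrix.of_apply, sndMat, superTranspose]
  split_ifs with h
  · rw [← mul_assoc, ← mul_assoc, ← pow_add, ← pow_add]
    congr 1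
    refine neg_one_pow_congr_of_even_add ?_
    simp only [Nat.even_add, Nat.even_mul]
    grind
  · simp

/-! ### Entries of products with the elementary matrices -/

theorem fstMat_mul_apply (t : SIdx m n → SIdx m n → S)
    (X : Matrix (SIdx m n × SIdx m n) (SIdx m n × SIdx m n) S) (a b : SIdx m n × SIdx m n) :
    (fstMat t * X) a b = ∑ p, t a.1 p * X (p, a.2) b := by
  simp [fstMat, Matrix.mul_apply, Fintype.sum_prod_type]

theorem mul_fstMat_apply (t : SIdx m n → SIdx m n → S)
    (X : Matrix (SIdx m n × SIdx m n) (SIdx m n × SIdx m n) S) (a b : SIdx m n × SIdx m n) :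
    (X * fstMat t) a b = ∑ p, X a (p, b.2) * t p b.1 := by
  simp [fstMat, Matrix.mul_apply, Fintype.sum_prod_type]

theorem sndMat_mul_apply (t : SIdx m n → SIdx m n → S)
    (X : Matrix (SIdx m n × SIdx m n) (SIdx m n × SIdx m n) S) (a b : SIdx m n × SIdx m n) :
    (sndMat t * X) a b =
      ∑ p, (-1) ^ (par a.1 * (par a.2 + par p)) * t a.2 p * X (a.1, p) b := by
  simp only [sndMat, Matrix.mul_apply, Fintype.sum_prod_type, Matrix.of_apply]
  rw [Finset.sum_eq_single a.1]
  · simp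
  · intro q _ hq
    simp [hq.symm]
  · simp

theorem mul_sndMat_apply (t : SIdx m n → SIdx m n → S)
    (X : Matrix (SIdx m n × SIdx m n) (SIdx m n × SIdx m n) S) (a b : SIdx m n × SIdx m n) :
    (X * sndMat t) a b =
      ∑ p, X a (b.1, p) * ((-1) ^ (par b.1 * (par p + par b.2)) * t p b.2) := by
  simp only [sndMat, Matrix.mul_apply, Fintype.sum_prod_type, Matrix.of_apply]
  rw [Finset.sum_eq_single b.1]
  · simp
  · intro q _ hq
    simp [hq]
  · simp

theorem PMat_mul_apply (X : Matrix (SIdx m n × SIdx m n) (SIdx m n × SIdx m n) S)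
    (a b : SIdx m n × SIdx m n) :
    (PMat m n S * X) a b = (-1) ^ (par a.1 * par a.2) * X (a.2, a.1) b := by
  simp only [PMat, Matrix.mul_apply, Fintype.sum_prod_type, Matrix.of_apply]
  rw [Finset.sum_eq_single a.2, Finset.sum_eq_single a.1]
  · simp
  · intro q _ hq
    simp [hq.symm]
  · simp
  · intro q _ hq
    simp [hq.symm]
  · simp

theorem mul_PMat_apply (X : Matrix (SIdx m n × SIdx m n) (SIdx m n × SIdx m n) S)
    (a b : SIdx m n × SIdx m n) :
    (X * PMat m n S) a b = X a (b.2, b.1) * (-1) ^ (par b.1 * par b.2) := by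
  simp only [PMat, Matrix.mul_apply, Fintype.sum_prod_type, Matrix.of_apply]
  rw [Finset.sum_eq_single b.2, Finset.sum_eq_single b.1]
  · simp [mul_comm]
  · intro q _ hq
    simp [hq]
  · simp
  · intro q _ hq
    simp [hq]
  · simp

theorem QMat_mul_apply (X : Matrix (SIdx m n × SIdx m n) (SIdx m n × SIdx m n) S)
    (a b : SIdx m n × SIdx m n) :
    (QMat m n S * X) a b = if a.1 = a.2 then (-1) ^ par a.1 * ∑ p, X (p, p) b else 0 := by
  simp only [QMat, Matrix.mul_apply, Fintype.sum_prod_type, Matrix.of_apply]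
  split_ifs with h
  · simp [h, Finset.mul_sum]
  · simp [h]

theorem mul_QMat_apply (X : Matrix (SIdx m n × SIdx m n) (SIdx m n × SIdx m n) S)
    (a b : SIdx m n × SIdx m n) :
    (X * QMat m n S) a b = if b.1 = b.2 then ∑ p, X a (p, p) * (-1) ^ par p else 0 := by
  simp only [QMat, Matrix.mul_apply, Fintype.sum_prod_type, Matrix.of_apply]
  split_ifs with h
  · simp [h]
  · simp [h]

theorem PMat_mul_PMat : PMat m n S * PMat m n S = 1 := by
  ext ⟨i, k⟩ ⟨j, l⟩
  rw [PMat_mul_apply]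
  simp only [PMat, Matrix.of_apply, Matrix.one_apply, Prod.mk.injEq]
  by_cases h : i = j ∧ k = l
  · obtain ⟨rfl, rfl⟩ := h
    rw [if_pos ⟨rfl, rfl⟩, if_pos ⟨rfl, rfl⟩, mul_comm (par k), neg_one_pow_mul_self]
  · rw [if_neg h, if_neg (by tauto), mul_zero]

/-- The superdimension of ℂ^{m|n}. This is how m - n enters the argument. -/
theorem sum_neg_one_pow_par : ∑ i : SIdx m n, (-1 : S) ^ par i = (m : S) - n := by
  rw [Fin.sum_univ_add]
  simp [par, sub_eq_add_neg]

/-- `QMat` is a column times a row, and the pairing of the row with the column is the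
superdimension. -/
theorem QMat_mul_QMat : QMat m n S * QMat m n S = ((m : S) - n) • QMat m n S := by
  ext ⟨i, k⟩ ⟨j, l⟩
  rw [QMat_mul_apply, ← sum_neg_one_pow_par, Matrix.smul_apply]
  simp only [QMat, Matrix.of_apply, true_and]
  by_cases h : i = k
  · by_cases h' : j = l
    · simp only [h, h', if_true, true_and, smul_eq_mul, neg_one_pow_mul_comm]
    · simp [h']
  · simp [h]

theorem sndMat_mul (s t : SIdx m n → SIdx m n → S) :
    sndMat s * sndMat t = sndMat (Matrix.of s * Matrix.of t) := by
  ext ⟨i, k⟩ ⟨j, l⟩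
  rw [sndMat_mul_apply]
  simp only [sndMat, Matrix.of_apply, Matrix.mul_apply]
  split_ifs with h
  · rw [Finset.mul_sum]
    refine Finset.sum_congr rfl fun p _ => ?_
    rw [sign_mul_sign_mul]
    congr 1
    refine neg_one_pow_congr_of_even_add ?_
    simp only [Nat.even_add, Nat.even_mul]
    grind
  · simp

theorem sndMat_one : sndMat (fun i j : SIdx m n => (1 : Matrix _ _ S) i j) = 1 := by
  ext ⟨i, k⟩ ⟨j, l⟩
  simp only [sndMat, Matrix.of_apply, Matrix.one_apply, Prod.mk.injEq]
  by_cases h : i = j ∧ k = l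
  · obtain ⟨rfl, rfl⟩ := h
    simp only [if_true, and_self, mul_one]
    exact Even.neg_one_pow ⟨par i * par k, by ring⟩
  · by_cases h' : i = j <;> by_cases h'' : k = l <;> simp_all

/-! ### Transposing products of matrices on the two factors -/

theorem transposeMat_sub (X Y : Matrix (SIdx m n × SIdx m n) (SIdx m n × SIdx m n) S) :
    transposeMat (X - Y) = transposeMat X - transposeMat Y := by
  ext a b; simp [transposeMat, mul_sub]

theorem transposeMat_sndMat_mul_fstMat (s t : SIdx m n → SIdx m n → S) :
    transposeMat (sndMat s * fstMat t) = sndMat (superTranspose s) * fstMat t := by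
  ext ⟨i, k⟩ ⟨j, l⟩
  simp only [transposeMat, Matrix.of_apply, mul_fstMat_apply, sndMat, superTranspose,
    Finset.mul_sum]
  refine Finset.sum_congr rfl fun p _ => ?_
  split_ifs with h
  · simp only [← mul_assoc, ← pow_add]
    congr 2
    refine neg_one_pow_congr_of_even_add ?_
    simp only [Nat.even_add, Nat.even_mul]
    grind
  · simp

theorem transposeMat_fstMat_mul_sndMat (s t : SIdx m n → SIdx m n → S) :
    transposeMat (fstMat t * sndMat s) = fstMat t * sndMat (superTranspose s) := by
  ext ⟨i, k⟩ ⟨j, l⟩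
  simp only [transposeMat, Matrix.of_apply, fstMat_mul_apply, sndMat, superTranspose,
    Finset.mul_sum]
  refine Finset.sum_congr rfl fun p _ => ?_
  split_ifs with h
  · simp only [← mul_assoc, ← pow_add, neg_one_pow_mul_comm _ (t i p)]
    congr 2
    refine neg_one_pow_congr_of_even_add ?_
    simp only [Nat.even_add, Nat.even_mul]
    grind
  · simp

/-- Transposition reverses the order in the second tensor factor only. The factor on the left of P
therefore ends up on the right of Q, while in `S` the entries of `s` still stand to the left of
those of `t`, so no commutativity of entries is needed. -/
theorem transposeMat_sndMat_mul_PMat_mul_fstMat (s t : SIdx m n → SIdx m n → S) :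
    transposeMat (sndMat s * PMat m n S * fstMat t) =
      QMat m n S * sndMat (superTranspose s) * fstMat t := by
  ext ⟨i, k⟩ ⟨j, l⟩
  rw [mul_assoc (QMat m n S), QMat_mul_apply]
  simp only [transposeMat, Matrix.of_apply, mul_fstMat_apply, mul_PMat_apply, sndMat,
    superTranspose, Finset.mul_sum]
  by_cases h : i = k
  · subst h
    simp only [if_true]
    rw [Finset.sum_comm' (t' := Finset.univ) (s' := fun _ => Finset.univ) (by simp)]
    refine Finset.sum_congr rfl fun p _ => ?_
    rw [Finset.sum_eq_single p]
    · simp only [if_true, mul_assoc, neg_one_pow_left_comm _ (s l p)]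
      simp only [← mul_assoc, ← pow_add]
      congr 2
      refine neg_one_pow_congr_of_even_add ?_
      simp only [Nat.even_add, Nat.even_mul]
      grind
    · intro q _ hq
      simp [hq]
    · simp
  · simp [h]

theorem transposeMat_fstMat_mul_PMat_mul_sndMat (s t : SIdx m n → SIdx m n → S) :
    transposeMat (fstMat t * PMat m n S * sndMat s) =
      fstMat t * sndMat (superTranspose s) * QMat m n S := by
  ext ⟨i, k⟩ ⟨j, l⟩
  rw [mul_QMat_apply]
  simp only [transposeMat, Matrix.of_apply, mul_sndMat_apply, mul_PMat_apply, fstMat,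
    superTranspose, Finset.mul_sum]
  by_cases h : j = l
  · subst h
    simp only [if_true]
    refine Finset.sum_congr rfl fun p _ => ?_
    rw [Finset.sum_eq_single k]
    · simp only [if_true, mul_assoc, neg_one_pow_mul_comm _ (s p k),
        neg_one_pow_left_comm _ (t i p)]
      simp only [← mul_assoc, ← pow_add]
      congr 2
      refine neg_one_pow_congr_of_even_add ?_
      simp only [Nat.even_add, Nat.even_mul]
      grind
    · intro q _ hq
      simp [hq.symm]
    · simp
  · simp [h, Ne.symm h]

end SMat

end Twist

/-! ## Shifts of series in `u⁻¹` -/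

section ShiftInv

open PowerSeries

variable {B : Type*} [CommRing B]

/-- The expansion of `(u - a)⁻¹` in `u⁻¹`. -/
noncomputable def invLinear (a : B) : PowerSeries B := X * mk fun r => a ^ r

/-- Equivalent to (1 - aX) · `invLinear a` = X, the geometric series. The later identities are
derived from this linear equation. -/
theorem invLinear_eq (a : B) : invLinear a = X + C a * X * invLinear a := by
  ext d
  match d with
  | 0 => simp [invLinear]
  | 1 => simp [invLinear, mul_assoc, coeff_X]
  | d + 2 =>
    rw [invLinear, map_add, coeff_succ_X_mul, mul_assoc, coeff_C_mul, coeff_succ_X_mul,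
      coeff_succ_X_mul, coeff_mk, coeff_mk, coeff_X, if_neg (by omega), zero_add, pow_succ']

theorem constantCoeff_invLinear (a : B) : constantCoeff (invLinear a) = 0 := by
  simp [invLinear]

theorem hasSubst_invLinear (a : B) : HasSubst (invLinear a) :=
  HasSubst.of_constantCoeff_zero' (constantCoeff_invLinear a)

/-- Multiplying `invLinear_eq` by a power of `invLinear a` yields a recursion on coefficients, which
is Pascal's rule. The truncated `d - 1` at `d = 0` is harmless: only `k = 0` survives there, with
binomial coefficient 1. -/
theorem coeff_invLinear_pow (a : B) (d k : ℕ) : coeff d (invLinear a ^ k) =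
    if k ≤ d then ((d - 1).choose (d - k) : B) * a ^ (d - k) else 0 := by
  induction d generalizing k with
  | zero =>
    cases k with
    | zero => simp
    | succ k => simp [constantCoeff_invLinear]
  | succ d ih =>
    cases k with
    | zero => simp [coeff_one]
    | succ k =>
      have h : invLinear a ^ (k + 1) = X * invLinear a ^ k + C a * (X * invLinear a ^ (k + 1)) := by
        rw [pow_succ']
        linear_combination invLinear a ^ k * invLinear_eq a
      rw [h, map_add, coeff_succ_X_mul, coeff_C_mul, coeff_succ_X_mul, ih, ih]
      by_cases hkd : k ≤ d
      · rw [if_pos hkd, if_pos (by omega : k + 1 ≤ d + 1), show d + 1 - (k + 1) = d - k by omega]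
        obtain ⟨e, rfl⟩ := Nat.exists_eq_add_of_le hkd
        cases e with
        | zero => simp
        | succ e =>
          rw [if_pos (by omega), show k + (e + 1) - k = e + 1 by omega,
            show k + (e + 1) - (k + 1) = e by omega, show k + (e + 1) - 1 = k + e by omega,
            show k + (e + 1) + 1 - 1 = k + e + 1 by omega, Nat.choose_succ_succ]
          push_cast
          ring
      · rw [if_neg hkd, if_neg (by omega), if_neg (by omega)]
        simp

/-- The resolvent identity for (u - a)⁻¹ and (u - b)⁻¹, obtained by cancelling the units 1 - aX and
1 - bX. -/
theorem invLinear_eq_sub (a b : B) :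
    invLinear a = invLinear b - C (b - a) * (invLinear b * invLinear a) := by
  have ha := invLinear_eq a
  have hb := invLinear_eq b
  have hu : IsUnit ((1 - C a * X) * (1 - C b * X) : PowerSeries B) := by
    rw [isUnit_iff_constantCoeff]
    simp
  refine hu.mul_left_cancel ?_
  have ha' : (1 - C a * X) * invLinear a = X := by linear_combination ha
  have hb' : (1 - C b * X) * invLinear b = X := by linear_combination hb
  rw [map_sub]
  linear_combination (1 - C b * X) * ha' - (1 - C a * X) * hb' +
    (C b - C a) * ((1 - C b * X) * invLinear b * ha' + X * hb')

variable [Algebra ℂ B]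

/-- Identifies the explicit binomial expansion with substitution of (u - a)⁻¹ for u⁻¹.
Multiplicativity and composition of shifts then come from general facts on substitution. -/
theorem shiftInv_eq_subst (f : PowerSeries ℂ) (a : B) : shiftInv f a = f.subst (invLinear a) := by
  ext d
  rw [shiftInv, coeff_mk, coeff_subst' (hasSubst_invLinear a)]
  -- The `k`-th power of `invLinear a` starts in degree `k`, so only `k ≤ d` contributes.
  rw [finsum_eq_sum_of_support_subset (s := Finset.range (d + 1))]
  · refine Finset.sum_congr rfl fun k hk => ?_
    rw [coeff_invLinear_pow, if_pos (by have := Finset.mem_range.1 hk; omega), mul_smul,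
      Nat.cast_smul_eq_nsmul, nsmul_eq_mul]
  · intro k hk
    simp only [Function.mem_support, coeff_invLinear_pow] at hk
    by_contra h
    simp only [Finset.coe_range, Set.mem_Iio] at h
    rw [if_neg (by omega), smul_zero] at hk
    exact hk rfl

theorem shiftInv_mul (f g : PowerSeries ℂ) (a : B) :
    shiftInv (f * g) a = shiftInv f a * shiftInv g a := by
  simp only [shiftInv_eq_subst, subst_mul (hasSubst_invLinear a)]

theorem shiftInv_X (a : B) : shiftInv X a = invLinear a := by
  rw [shiftInv_eq_subst, subst_X (hasSubst_invLinear a)]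

/-- Both sides solve w = (u - a)⁻¹ + α (u - a)⁻¹ w, whose solution is unique because 1 - α (u - a)⁻¹
is a unit. -/
theorem subst_invLinear (α : ℂ) (a : B) :
    (invLinear α).subst (invLinear a) = invLinear (algebraMap ℂ B α + a) := by
  have hs := hasSubst_invLinear a
  have h1 := congrArg (PowerSeries.subst (invLinear a)) (invLinear_eq α)
  rw [subst_add hs, subst_mul hs, subst_mul hs, subst_X hs] at h1
  have h0 : PowerSeries.subst (invLinear a) (C α : PowerSeries ℂ) = C (algebraMap ℂ B α) := by
    have := PowerSeries.subst_smul hs α (1 : PowerSeries ℂ)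
    rw [← coe_substAlgHom hs, map_one, smul_eq_C_mul, mul_one] at this
    rw [← coe_substAlgHom hs, this]
    change (α • (1 : PowerSeries B)) = _
    ext d
    rw [coeff_smul, coeff_C, coeff_one]
    split_ifs <;> simp [Algebra.smul_def]
  rw [h0] at h1
  set w := PowerSeries.subst (invLinear a) (invLinear α)
  have h2 := invLinear_eq_sub (algebraMap ℂ B α + a) a
  rw [show a - (algebraMap ℂ B α + a) = - algebraMap ℂ B α by ring, map_neg] at h2
  have hu : IsUnit (1 - C (algebraMap ℂ B α) * invLinear a) := by
    rw [isUnit_iff_constantCoeff]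
    simp [constantCoeff_invLinear]
  refine hu.mul_left_cancel ?_
  linear_combination h1 - h2

theorem shiftInv_shiftInv (f : PowerSeries ℂ) (α : ℂ) (a : B) :
    shiftInv (shiftInv f α) a = shiftInv f (algebraMap ℂ B α + a) := by
  rw [shiftInv_eq_subst, shiftInv_eq_subst f α, shiftInv_eq_subst,
    subst_comp_subst_apply (hasSubst_invLinear α) (hasSubst_invLinear a), subst_invLinear]

/-- The functional equation of g with its argument shifted by a + N: g(u - a) = (1 - (u - a - N)⁻²)
g(u - a - N). It provides the scalar compatibilities `hF` and `hH` in `mul_contraction_comm`. -/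
theorem shiftInv_gSeries (N : ℂ) (hN : N ≠ 0) (a : B) :
    shiftInv (gSeries N) a = (1 - invLinear (a + algebraMap ℂ B N) ^ 2) *
      shiftInv (gSeries N) (a + algebraMap ℂ B N) := by
  have hs := hasSubst_invLinear (a + algebraMap ℂ B N)
  have h := congrArg (fun f => shiftInv f (a + algebraMap ℂ B N)) (gSeries_spec N hN)
  simp only [shiftInv_shiftInv, shiftInv_mul] at h
  rw [show algebraMap ℂ B (-N) + (a + algebraMap ℂ B N) = a by rw [map_neg]; ring] at h
  rw [h, shiftInv_eq_subst (1 - X ^ 2), subst_sub hs, subst_pow hs, subst_X hs]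
  rw [← coe_substAlgHom hs, map_one]

theorem invLinear_eq_sub_natCast (m n : ℕ) (a : B) : invLinear a =
    invLinear (a + algebraMap ℂ B ((m : ℂ) - n)) -
      (m - n) * (invLinear (a + algebraMap ℂ B ((m : ℂ) - n)) * invLinear a) := by
  have h := invLinear_eq_sub a (a + algebraMap ℂ B ((m : ℂ) - n))
  rw [add_sub_cancel_left, map_sub, map_natCast, map_natCast, map_sub, map_natCast,
    map_natCast] at h
  simpa only [map_sub, map_natCast] using h

theorem isUnit_shiftInv_gSeries (N : ℂ) (a : B) : IsUnit (shiftInv (gSeries N) a) := by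
  rw [isUnit_iff_constantCoeff, ← coeff_zero_eq_constantCoeff_apply, shiftInv, coeff_mk]
  simp [gSeries_constantCoeff]

theorem map_shiftInv {B A : Type*} [Ring B] [Algebra ℂ B] [Ring A] [Algebra ℂ A] (φ : B →ₐ[ℂ] A)
    (f : PowerSeries ℂ) (a : B) :
    PowerSeries.map (φ : B →+* A) (shiftInv f a) = shiftInv f (φ a) := by
  ext d
  simp [shiftInv]

end ShiftInv

/-! ## The exchange of the quantum contraction with `T(u)`, in matrix form -/

section Exchange

variable {Z M : Type*} [CommRing Z] [Ring M] [Algebra Z M]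

/-- Unitarity of the Yang R-matrix. -/
theorem one_add_mul_one_sub_of_sq_eq_one {P : M} (hP : P * P = 1) (x : Z) :
    (1 + x • P) * (1 - x • P) = (1 - x ^ 2) • (1 : M) := by
  simp only [add_mul, mul_sub, one_mul, mul_one, smul_mul_assoc, mul_smul_comm, hP]
  module

/-- Crossing symmetry: the inverse of a transposed R-matrix has the same shape with a shifted
parameter. The hypothesis `h` is the resolvent identity for x = w⁻¹ and y = (w - N)⁻¹. -/
theorem one_sub_mul_one_add_of_sq_eq_smul {Q : M} {N : Z} (hQ : Q * Q = N • Q) {x y : Z}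
    (h : x = y - N * (y * x)) : (1 - x • Q) * (1 + y • Q) = 1 := by
  simp only [mul_add, sub_mul, one_mul, mul_one, smul_mul_assoc, mul_smul_comm, hQ]
  have h0 : (y - x - N * (y * x)) • Q = 0 := by
    rw [show y - x - N * (y * x) = 0 by linear_combination -h, zero_smul]
  refine Eq.trans ?_ ((congrArg (1 + ·) h0).trans (add_zero 1))
  module

/-- If `T₀` can be moved through `T₁` and `S` by `R`-matrices which are related by crossing
symmetry, then `T₀` commutes with the contraction `z` of `T₁` and `S`. -/
theorem mul_contraction_comm {F f H h x X y Y N : Z} {P Q Q' T₀ T₁ S z : M}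
    (h1 : f • (1 - x • P) * (T₀ * T₁) = T₁ * T₀ * (h • (1 - y • P)))
    (h2 : F • (1 - X • Q) * (S * T₀) = T₀ * S * (H • (1 - Y • Q)))
    (hF : F = (1 - x ^ 2) * f) (hH : H = (1 - y ^ 2) * h)
    (hX : X = x - N * (x * X)) (hY : Y = y - N * (y * Y))
    (hP : P * P = 1) (hQ : Q * Q = N • Q) (hPS : P * S = S * P) (hQT : Q * T₁ = T₁ * Q)
    (hQT₀ : Q' * T₀ = T₀ * Q') (hz : Q' * (T₁ * S) = z * Q') (hPQ : Q' * P = Q' * Q)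
    (hFu : IsUnit F) (hHu : IsUnit H) : T₀ * z * Q' = z * T₀ * Q' := by
  -- Unitarity inverts the R-matrix on the left, and the factor 1 - x² it produces turns `f` into
  -- `F`.
  have e1 : F • (T₀ * T₁) = (1 + x • P) * T₁ * T₀ * (h • (1 - y • P)) := by
    rw [mul_assoc (1 + x • P), mul_assoc (1 + x • P), ← h1, smul_mul_assoc, mul_smul_comm,
      ← mul_assoc, one_add_mul_one_sub_of_sq_eq_one hP, smul_mul_assoc, one_mul, smul_smul, hF,
      mul_comm]
  -- Crossing inverts the transposed R-matrix on the right.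
  have e2 : H • (T₀ * S) = F • (1 - X • Q) * (S * T₀) * (1 + y • Q) := by
    rw [h2, mul_assoc, smul_mul_assoc, one_sub_mul_one_add_of_sq_eq_smul hQ hY, mul_smul_comm,
      mul_one]
  have c1 : (1 - y • P) * S = S * (1 - y • P) := by
    simp only [mul_sub, sub_mul, one_mul, mul_one, smul_mul_assoc, mul_smul_comm, hPS]
  have c2 : T₁ * (1 - X • Q) = (1 - X • Q) * T₁ := by
    simp only [mul_sub, sub_mul, one_mul, mul_one, smul_mul_assoc, mul_smul_comm, hQT]
  -- Next to `Q'` the operator `P` may be replaced by `Q`, after which crossing cancels both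
  -- factors.
  have q1 : Q' * ((1 + x • P) * (1 - X • Q)) = Q' := by
    have : Q' * (1 + x • P) = Q' * (1 + x • Q) := by
      simp only [mul_add, mul_smul_comm, hPQ]
    rw [← mul_assoc, this, mul_assoc]
    simp only [mul_sub, mul_add, add_mul, one_mul, mul_one, smul_mul_assoc, mul_smul_comm, hQ]
    have h0 : (x - X - N * (x * X)) • (Q' * Q) = 0 := by
      rw [show x - X - N * (x * X) = 0 by linear_combination -hX, zero_smul]
    refine Eq.trans ?_ ((congrArg (Q' + ·) h0).trans (add_zero Q'))
    module
  -- Here the replacement runs the other way, from `Q` to `P`, and unitarity leaves the scalar 1 -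
  -- y².
  have q2 : Q' * ((1 + y • Q) * (1 - y • P)) = (1 - y ^ 2) • Q' := by
    have : Q' * (1 + y • Q) = Q' * (1 + y • P) := by
      simp only [mul_add, mul_smul_comm, hPQ]
    rw [← mul_assoc, this, mul_assoc, one_add_mul_one_sub_of_sq_eq_one hP, mul_smul_comm, mul_one]
  -- `T₀` has passed `T₁` and `S`. `P` commutes with `S` and `Q` with `T₁`, so the four R-matrices
  -- collect in two pairs around T₁ S T₀.
  have e3 : (F * H) • (T₀ * T₁ * S) =
      (F * h) • ((1 + x • P) * (1 - X • Q) * (T₁ * S) * T₀ * ((1 + y • Q) * (1 - y • P))) := by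
    calc (F * H) • (T₀ * T₁ * S) = H • (F • (T₀ * T₁) * S) := by
          rw [smul_mul_assoc, smul_smul, mul_comm]
      _ = h • ((1 + x • P) * T₁ * (H • (T₀ * S)) * (1 - y • P)) := by
          rw [e1]
          simp only [mul_smul_comm, smul_mul_assoc, mul_assoc, c1]
          rw [smul_comm]
      _ = (F * h) • ((1 + x • P) * (T₁ * (1 - X • Q)) * (S * T₀) *
            ((1 + y • Q) * (1 - y • P))) := by
          rw [e2]
          simp only [mul_smul_comm, smul_mul_assoc, mul_assoc, smul_smul, mul_comm]
      _ = _ := by rw [c2]; simp only [mul_assoc]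
  have e4 := congrArg (Q' * ·) e3
  simp only [mul_smul_comm] at e4
  have l1 : Q' * (T₀ * T₁ * S) = T₀ * z * Q' := by
    rw [mul_assoc, ← mul_assoc, hQT₀, mul_assoc, hz, mul_assoc]
  have l2 : Q' * ((1 + x • P) * (1 - X • Q) * (T₁ * S) * T₀ * ((1 + y • Q) * (1 - y • P))) =
      (1 - y ^ 2) • (z * T₀ * Q') := by
    calc _ = Q' * ((1 + x • P) * (1 - X • Q)) * (T₁ * S) * T₀ * ((1 + y • Q) * (1 - y • P)) := by
          simp only [mul_assoc]
      _ = z * T₀ * (Q' * ((1 + y • Q) * (1 - y • P))) := by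
          rw [q1, hz, mul_assoc z, hQT₀]
          simp only [mul_assoc]
      _ = _ := by rw [q2, mul_smul_comm]
  -- H = (1 - y²) h makes the scalars on the two sides equal, and the unit F H cancels.
  rw [l1, l2, smul_smul, show F * h * (1 - y ^ 2) = F * H by rw [hH]; ring] at e4
  exact (hFu.mul hHu).smul_left_cancel.1 e4

end Exchange

/-! ## Three tensor factors -/

namespace SMat

section Three

variable {m n : ℕ} {S : Type*} [Ring S]

/-- A matrix on the tensor factors 0 and 1. -/
def left (X : Matrix (SIdx m n × SIdx m n) (SIdx m n × SIdx m n) S) :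
    Matrix (SIdx m n × SIdx m n × SIdx m n) (SIdx m n × SIdx m n × SIdx m n) S :=
  Matrix.of fun a b => if a.2.2 = b.2.2 then X (a.1, a.2.1) (b.1, b.2.1) else 0

/-- A matrix on the tensor factors 0 and 2. -/
def outer (X : Matrix (SIdx m n × SIdx m n) (SIdx m n × SIdx m n) S) :
    Matrix (SIdx m n × SIdx m n × SIdx m n) (SIdx m n × SIdx m n × SIdx m n) S :=
  Matrix.of fun a b => if a.2.1 = b.2.1 then
    (-1) ^ (par a.2.1 * (par a.2.2 + par b.2.2)) * X (a.1, a.2.2) (b.1, b.2.2) else 0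

/-- A matrix on the tensor factors 1 and 2. -/
def right (X : Matrix (SIdx m n × SIdx m n) (SIdx m n × SIdx m n) S) :
    Matrix (SIdx m n × SIdx m n × SIdx m n) (SIdx m n × SIdx m n × SIdx m n) S :=
  Matrix.of fun a b => if a.1 = b.1 then
    (-1) ^ (par a.1 * (par a.2.1 + par b.2.1 + par a.2.2 + par b.2.2)) * X a.2 b.2 else 0

theorem left_mul (X Y : Matrix (SIdx m n × SIdx m n) (SIdx m n × SIdx m n) S) :
    left (X * Y) = left X * left Y := by
  ext ⟨i, p, k⟩ ⟨j, q, l⟩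
  simp only [left, Matrix.mul_apply, Matrix.of_apply, Fintype.sum_prod_type]
  by_cases h : k = l <;> simp [h]

theorem outer_mul (X Y : Matrix (SIdx m n × SIdx m n) (SIdx m n × SIdx m n) S) :
    outer (X * Y) = outer X * outer Y := by
  ext ⟨i, p, k⟩ ⟨j, q, l⟩
  simp only [outer, Matrix.mul_apply, Matrix.of_apply, Fintype.sum_prod_type]
  by_cases h : p = q
  · subst h
    simp only [if_true, Finset.mul_sum]
    refine Finset.sum_congr rfl fun r _ => ?_
    symm
    rw [Finset.sum_eq_single p]
    · simp only [if_true]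
      refine Finset.sum_congr rfl fun r _ => ?_
      rw [sign_mul_sign_mul]
      congr 1
      refine neg_one_pow_congr_of_even_add ?_
      simp only [Nat.even_add, Nat.even_mul]
      grind
    · intro q _ hq
      simp [hq, hq.symm]
    · simp
  · rw [if_neg h]
    refine (Finset.sum_eq_zero fun r _ => Finset.sum_eq_zero fun r' _ =>
      Finset.sum_eq_zero fun _ _ => ?_).symm
    by_cases h' : p = r'
    · simp [← h', h]
    · simp [h']

theorem right_mul (X Y : Matrix (SIdx m n × SIdx m n) (SIdx m n × SIdx m n) S) :
    right (X * Y) = right X * right Y := by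
  ext ⟨i, p, k⟩ ⟨j, q, l⟩
  simp only [right, Matrix.mul_apply, Matrix.of_apply, Fintype.sum_prod_type]
  symm
  rw [Finset.sum_eq_single i]
  · by_cases h : i = j
    · subst h
      simp only [if_true, Finset.mul_sum]
      refine Finset.sum_congr rfl fun r _ => Finset.sum_congr rfl fun r' _ => ?_
      rw [sign_mul_sign_mul]
      congr 1
      refine neg_one_pow_congr_of_even_add ?_
      simp only [Nat.even_add, Nat.even_mul]
      grind
    · simp [h]
  · intro q _ hq
    simp [hq.symm]
  · simp

theorem left_one : left (1 : Matrix _ _ S) = (1 : Matrix (SIdx m n × SIdx m n × SIdx m n) _ S) := by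
  ext ⟨i, p, k⟩ ⟨j, q, l⟩
  simp only [left, Matrix.of_apply, Matrix.one_apply, Prod.mk.injEq]
  by_cases h : k = l <;> simp [h]

theorem outer_one :
    outer (1 : Matrix _ _ S) = (1 : Matrix (SIdx m n × SIdx m n × SIdx m n) _ S) := by
  ext ⟨i, p, k⟩ ⟨j, q, l⟩
  simp only [outer, Matrix.of_apply, Matrix.one_apply, Prod.mk.injEq]
  by_cases h : p = q <;> by_cases h' : k = l <;> simp [h, h']

theorem left_sub (X Y : Matrix (SIdx m n × SIdx m n) (SIdx m n × SIdx m n) S) :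
    left (X - Y) = left X - left Y := by
  ext a b
  simp only [left, Matrix.of_apply, Matrix.sub_apply]
  split_ifs <;> simp

theorem outer_sub (X Y : Matrix (SIdx m n × SIdx m n) (SIdx m n × SIdx m n) S) :
    outer (X - Y) = outer X - outer Y := by
  ext a b
  simp only [outer, Matrix.of_apply, Matrix.sub_apply]
  split_ifs <;> simp [mul_sub]

theorem outer_fstMat (t : SIdx m n → SIdx m n → S) : outer (fstMat t) = left (fstMat t) := by
  ext ⟨i, p, k⟩ ⟨j, q, l⟩
  simp only [outer, left, fstMat, Matrix.of_apply]
  by_cases h : p = q <;> by_cases h' : k = l <;> simp [h, h']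

/-- Tensor factor 1 is the first member of the pair (1, 2) and the second member of (0, 1). The sign
conventions make the two embeddings agree. -/
theorem right_fstMat (t : SIdx m n → SIdx m n → S) : right (fstMat t) = left (sndMat t) := by
  ext ⟨i, p, k⟩ ⟨j, q, l⟩
  simp only [right, left, fstMat, sndMat, Matrix.of_apply]
  by_cases h : i = j
  · by_cases h' : k = l
    · subst h h'
      simp only [if_true]
      congr 1
      refine neg_one_pow_congr_of_even_add ?_
      simp only [Nat.even_add, Nat.even_mul]
      grind
    · simp [h']
  · simp [h]

theorem right_sndMat (t : SIdx m n → SIdx m n → S) : right (sndMat t) = outer (sndMat t) := by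
  ext ⟨i, p, k⟩ ⟨j, q, l⟩
  simp only [right, outer, sndMat, Matrix.of_apply]
  by_cases h : i = j
  · by_cases h' : p = q
    · subst h h'
      simp only [if_true, ← mul_assoc, ← pow_add]
      congr 1
      refine neg_one_pow_congr_of_even_add ?_
      simp only [Nat.even_add, Nat.even_mul]
      grind
    · simp [h']
  · simp [h]

/-! ### The contraction of tensor factors 1 and 2 -/

theorem right_QMat_apply (a b : SIdx m n × SIdx m n × SIdx m n) : right (QMat m n S) a b =
    if a.1 = b.1 ∧ a.2.1 = a.2.2 ∧ b.2.1 = b.2.2 then (-1) ^ par a.2.1 else 0 := by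
  obtain ⟨i, p, k⟩ := a
  obtain ⟨j, q, l⟩ := b
  simp only [right, QMat, Matrix.of_apply]
  by_cases h : i = j
  · by_cases h' : p = k ∧ q = l
    · obtain ⟨rfl, rfl⟩ := h'
      subst h
      simp only [if_true, and_self, ← pow_add]
      refine neg_one_pow_congr_of_even_add ?_
      simp only [Nat.even_add, Nat.even_mul]
      grind
    · simp [h']
  · simp [h]

theorem right_QMat_mul_apply (X : Matrix (SIdx m n × SIdx m n × SIdx m n) _ S)
    (a b : SIdx m n × SIdx m n × SIdx m n) : (right (QMat m n S) * X) a b =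
      if a.2.1 = a.2.2 then (-1) ^ par a.2.1 * ∑ p, X (a.1, p, p) b else 0 := by
  simp only [Matrix.mul_apply, Fintype.sum_prod_type, right_QMat_apply]
  rw [Finset.sum_eq_single a.1]
  · split_ifs with h
    · simp [h, Finset.mul_sum]
    · simp [h]
  · intro q _ hq
    simp [hq.symm]
  · simp

/-- Contracting factors 1 and 2 lets an operator on factor 1 be traded for its transpose on factor
2, and Q is the transpose of P. This is what allows unitarity and crossing to work against each
other. -/
theorem right_QMat_mul_PMat :
    right (QMat m n S) * left (PMat m n S) = right (QMat m n S) * outer (QMat m n S) := by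
  ext ⟨i, p, k⟩ ⟨j, q, l⟩
  rw [right_QMat_mul_apply, right_QMat_mul_apply]
  simp only [left, outer, PMat, QMat, Matrix.of_apply]
  split_ifs
  · congr 1
    rw [Finset.sum_eq_single j, Finset.sum_eq_single i]
    · by_cases h : i = q ∧ j = l
      · obtain ⟨rfl, rfl⟩ := h
        simp only [if_true, and_self, ← pow_add]
        refine neg_one_pow_congr_of_even_add ?_
        simp only [Nat.even_add, Nat.even_mul]
        grind
      · by_cases h1 : i = q <;> by_cases h2 : j = l <;> simp_all
    · intro r _ hr
      simp [hr.symm]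
    · simp
    · intro r _ hr
      simp [hr]
    · simp
  · rfl

theorem left_fstMat_mul_apply (t : SIdx m n → SIdx m n → S)
    (X : Matrix (SIdx m n × SIdx m n × SIdx m n) (SIdx m n × SIdx m n × SIdx m n) S)
    (a b : SIdx m n × SIdx m n × SIdx m n) :
    (left (fstMat t) * X) a b = ∑ r, t a.1 r * X (r, a.2) b := by
  simp only [Matrix.mul_apply, Fintype.sum_prod_type, left, fstMat, Matrix.of_apply]
  refine Finset.sum_congr rfl fun r _ => ?_
  rw [Finset.sum_eq_single a.2.1, Finset.sum_eq_single a.2.2]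
  all_goals first | (intro r _ hr; simp [hr.symm]) | simp

/-- Here and in `PMat_mul_sndMat` and `QMat_mul_sndMat`, operators on disjoint tensor factors
commute because one of the two has all entries in {0, ±1}. -/
theorem right_QMat_mul_fstMat (t : SIdx m n → SIdx m n → S) :
    right (QMat m n S) * left (fstMat t) = left (fstMat t) * right (QMat m n S) := by
  ext ⟨i, p, k⟩ ⟨j, q, l⟩
  rw [right_QMat_mul_apply, left_fstMat_mul_apply]
  simp only [right_QMat_apply, left, fstMat, Matrix.of_apply]
  rw [Finset.sum_eq_single q, Finset.sum_eq_single j]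
  · by_cases h : p = k <;> by_cases h' : q = l <;> simp [h, h', neg_one_pow_mul_comm]
  all_goals first | (intro r _ hr; simp [hr]) | simp

theorem PMat_mul_sndMat (s : SIdx m n → SIdx m n → S) :
    left (PMat m n S) * outer (sndMat s) = outer (sndMat s) * left (PMat m n S) := by
  ext ⟨i, p, k⟩ ⟨j, q, l⟩
  simp only [Matrix.mul_apply, Fintype.sum_prod_type, left, outer, PMat, sndMat, Matrix.of_apply]
  rw [Finset.sum_eq_single p, Finset.sum_eq_single i, Finset.sum_eq_single k,
    Finset.sum_eq_single i, Finset.sum_eq_single p, Finset.sum_eq_single l]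
  · by_cases h : i = q
    · by_cases h' : p = j
      · subst h h'
        simp only [if_true, and_self, mul_assoc, neg_one_pow_mul_comm _ (s k l)]
        simp only [← mul_assoc, ← pow_add]
        congr 1
        refine neg_one_pow_congr_of_even_add ?_
        simp only [Nat.even_add, Nat.even_mul]
        grind
      · simp [h']
    · simp [h]
  all_goals first | (intro r _ hr; simp [hr, hr.symm]) | simp

theorem QMat_mul_sndMat (w : SIdx m n → SIdx m n → S) :
    outer (QMat m n S) * left (sndMat w) = left (sndMat w) * outer (QMat m n S) := by
  ext ⟨i, p, k⟩ ⟨j, q, l⟩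
  simp only [Matrix.mul_apply, Fintype.sum_prod_type, left, outer, QMat, sndMat, Matrix.of_apply]
  rw [Finset.sum_eq_single j, Finset.sum_eq_single p, Finset.sum_eq_single l,
    Finset.sum_eq_single i, Finset.sum_eq_single q, Finset.sum_eq_single k]
  · by_cases h : i = k
    · by_cases h' : j = l
      · subst h h'
        simp only [if_true, and_self, ← mul_assoc, ← pow_add, mul_assoc _ (w p q),
          neg_one_pow_mul_comm _ (w p q)]
        congr 1
        refine neg_one_pow_congr_of_even_add ?_
        simp only [Nat.even_add, Nat.even_mul]
        grind
      · simp [h']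
    · simp [h]
  all_goals first | (intro r _ hr; simp [hr, hr.symm]) | simp

variable {Z : Type*} [CommRing Z] [Algebra Z S]

theorem left_smul (z : Z) (X : Matrix (SIdx m n × SIdx m n) (SIdx m n × SIdx m n) S) :
    left (z • X) = z • left X := by
  ext a b
  simp only [left, Matrix.of_apply, Matrix.smul_apply]
  split_ifs <;> simp

theorem outer_smul (z : Z) (X : Matrix (SIdx m n × SIdx m n) (SIdx m n × SIdx m n) S) :
    outer (z • X) = z • outer X := by
  ext a b
  simp only [outer, Matrix.of_apply, Matrix.smul_apply]
  split_ifs <;> simp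

/-- The contraction of `w` and `s` commutes with `t`, if `w` and `s` have exchange relations with
`t` whose `R`-matrices are related by crossing symmetry. -/
theorem contraction_comm {F f H h x X y Y : Z} {t s w : SIdx m n → SIdx m n → S} {z : S}
    (h1 : f • (1 - x • PMat m n S) * (fstMat t * sndMat w) =
      sndMat w * fstMat t * (h • (1 - y • PMat m n S)))
    (h2 : F • (1 - X • QMat m n S) * (sndMat s * fstMat t) =
      fstMat t * sndMat s * (H • (1 - Y • QMat m n S)))
    (hz : QMat m n S * (fstMat w * sndMat s) = Matrix.scalar _ z * QMat m n S)
    (hF : F = (1 - x ^ 2) * f) (hH : H = (1 - y ^ 2) * h)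
    (hX : X = x - (m - n) * (x * X)) (hY : Y = y - (m - n) * (y * Y))
    (hFu : IsUnit F) (hHu : IsUnit H) (i j : SIdx m n) : t i j * z = z * t i j := by
  have hQ : outer (QMat m n S) * outer (QMat m n S) =
      ((m : Z) - n) • outer (QMat m n S) := by
    rw [← outer_mul, QMat_mul_QMat, ← outer_smul]
    congr 1
    ext a b
    simp [Algebra.smul_def, sub_mul]
  have hP : left (PMat m n S) * left (PMat m n S) = 1 := by
    rw [← left_mul, PMat_mul_PMat, left_one]
  have hz' : right (QMat m n S) * (left (sndMat w) * outer (sndMat s)) =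
      Matrix.scalar _ z * right (QMat m n S) := by
    rw [← right_fstMat, ← right_sndMat, ← right_mul, ← right_mul, hz]
    ext a b
    simp only [right, Matrix.scalar_apply, Matrix.diagonal_mul, Matrix.of_apply]
    split_ifs
    · rw [← mul_assoc, ← neg_one_pow_mul_comm, mul_assoc]
    · simp
  have e1 := congrArg left h1
  simp only [left_mul, left_smul, left_sub, left_one] at e1
  have e2 := congrArg outer h2
  simp only [outer_mul, outer_smul, outer_sub, outer_one, outer_fstMat] at e2
  have key := mul_contraction_comm e1 e2 hF hH hX hY hP hQ (PMat_mul_sndMat s)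
    (QMat_mul_sndMat w) (right_QMat_mul_fstMat t) hz' right_QMat_mul_PMat hFu hHu
  rw [mul_assoc, mul_assoc] at key
  -- In this entry the contraction contributes a single sign, which can be cancelled, and the sum
  -- over the intermediate index reduces to `j`.
  have k2 := congrFun (congrFun key (i, i, i)) (j, i, i)
  simp only [left_fstMat_mul_apply, Matrix.scalar_apply, Matrix.diagonal_mul, right_QMat_apply,
    and_self, and_true] at k2
  rw [Finset.sum_eq_single j, Finset.sum_eq_single j] at k2
  · have k3 := congrArg (· * (-1 : S) ^ par i) k2
    simpa only [if_true, mul_assoc, neg_one_pow_mul_self, mul_one] using k3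
  all_goals first | (intro r _ hr; simp [hr]) | simp

end Three

end SMat

/-! ## Transposed relations and the contraction -/

namespace SMat

section Contraction

variable {m n : ℕ} {S Z : Type*} [Ring S] [CommRing Z] [Algebra Z S]

theorem transposeMat_smul (z : Z) (X : Matrix (SIdx m n × SIdx m n) (SIdx m n × SIdx m n) S) :
    transposeMat (z • X) = z • transposeMat X := by
  ext a b
  simp [transposeMat]

theorem sndMat_mul_eq_one {s w : SIdx m n → SIdx m n → S}
    (h : Matrix.of s * Matrix.of w = 1) : sndMat s * sndMat w = 1 := by
  rw [sndMat_mul, h]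
  exact sndMat_one

/-- An exchange relation of `t` and `w` gives one of `t` and the transpose of the inverse of `w`. -/
theorem transpose_exchange {f₁ f₂ h₁ h₂ : Z} {t s w : SIdx m n → SIdx m n → S}
    (hsw : Matrix.of s * Matrix.of w = 1) (hws : Matrix.of w * Matrix.of s = 1)
    (h : (f₁ • 1 - f₂ • PMat m n S) * (fstMat t * sndMat w) =
      sndMat w * fstMat t * (h₁ • 1 - h₂ • PMat m n S)) :
    (f₁ • 1 - f₂ • QMat m n S) * (sndMat (superTranspose s) * fstMat t) =
      fstMat t * sndMat (superTranspose s) * (h₁ • 1 - h₂ • QMat m n S) := by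
  -- Multiplying by the inverse from the left and from the right removes `w` and leaves one factor
  -- `s` on each side. In this form the relation can be transposed term by term.
  have e : sndMat s * (f₁ • 1 - f₂ • PMat m n S) * fstMat t =
      fstMat t * (h₁ • 1 - h₂ • PMat m n S) * sndMat s := by
    have := congrArg (fun A => sndMat s * A * sndMat s) h
    simp only [mul_assoc, sndMat_mul_eq_one hws, mul_one] at this
    simp only [← mul_assoc, sndMat_mul_eq_one hsw, one_mul] at this
    exact this
  have e' := congrArg transposeMat e
  simp only [mul_sub, sub_mul, mul_smul_comm, smul_mul_assoc, mul_one, transposeMat_sub,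
    transposeMat_smul, transposeMat_sndMat_mul_fstMat, transposeMat_fstMat_mul_sndMat,
    transposeMat_sndMat_mul_PMat_mul_fstMat, transposeMat_fstMat_mul_PMat_mul_sndMat] at e'
  simpa only [mul_sub, sub_mul, mul_smul_comm, smul_mul_assoc, mul_one, one_mul, mul_assoc] using e'

/-- Q has rank one, so compressing any matrix by Q gives a multiple of Q. -/
theorem QMat_mul_mul_QMat (A : Matrix (SIdx m n × SIdx m n) (SIdx m n × SIdx m n) S) :
    QMat m n S * A * QMat m n S =
      Matrix.scalar _ (∑ p, ∑ q, A (p, p) (q, q) * (-1) ^ par q) * QMat m n S := by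
  ext ⟨i, k⟩ ⟨j, l⟩
  rw [mul_assoc, QMat_mul_apply]
  simp only [Matrix.scalar_apply, Matrix.diagonal_mul, mul_QMat_apply]
  simp only [QMat, Matrix.of_apply]
  by_cases h : i = k
  · by_cases h' : j = l
    · simp only [h, h', if_true, and_self, neg_one_pow_mul_comm]
    · simp [h']
  · simp [h]

/-- The contraction of `t` and the inverse `s` of `w` is a multiple of `Q`. -/
theorem exists_contraction [Algebra ℂ S] (hmn : m ≠ n) {t s w : SIdx m n → SIdx m n → S}
    (hsw : Matrix.of s * Matrix.of w = 1) (hws : Matrix.of w * Matrix.of s = 1)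
    (h : (((m : ℂ) - n) • 1 - PMat m n S) * (fstMat t * sndMat w) =
      sndMat w * fstMat t * (((m : ℂ) - n) • 1 - PMat m n S)) :
    ∃ z : S, QMat m n S * (fstMat t * sndMat (superTranspose s)) =
      Matrix.scalar _ z * QMat m n S := by
  have hN : (m : ℂ) - n ≠ 0 := sub_ne_zero.2 (by exact_mod_cast hmn)
  have e := transpose_exchange (Z := ℂ) (f₁ := (m : ℂ) - n) (f₂ := 1) (h₁ := (m : ℂ) - n) (h₂ := 1)
    hsw hws (by simpa only [one_smul] using h)
  simp only [one_smul] at e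
  have hQQ : QMat m n S * QMat m n S = ((m : ℂ) - n) • QMat m n S := by
    rw [QMat_mul_QMat]
    ext a b
    simp [Algebra.smul_def]
  -- Q² = NQ makes Q annihilate N - Q. This explains the shift by exactly m - n in the contraction.
  have hQ : QMat m n S * (((m : ℂ) - n) • 1 - QMat m n S) = 0 := by
    rw [mul_sub, mul_smul_comm, mul_one, hQQ, sub_self]
  have e' := congrArg (QMat m n S * ·) e
  simp only [← mul_assoc, hQ, zero_mul] at e'
  rw [mul_sub, mul_smul_comm, mul_one, eq_comm, sub_eq_zero, mul_assoc (QMat m n S),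
    QMat_mul_mul_QMat] at e'
  set z := ∑ p, ∑ q, (fstMat t * sndMat (superTranspose s)) (p, p) (q, q) * (-1) ^ par q
  -- The relation `e'` gives N Q T S = Q T S Q = z Q, so the scalar sought is z / N.
  refine ⟨((m : ℂ) - n)⁻¹ • z, ?_⟩
  have e2 := congrArg (((m : ℂ) - n)⁻¹ • ·) e'
  simp only [smul_smul, inv_mul_cancel₀ hN, one_smul] at e2
  rw [e2]
  ext a b
  simp

theorem toMat_eq_QMat_mul (z : S) :
    toMat (fun i j k l => tau₂ P i j k l * z : SMat m n S) = Matrix.scalar _ z * QMat m n S := by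
  have h : toMat (fun i j k l => tau₂ P i j k l * z : SMat m n S) =
      Matrix.of fun a b => toMat (tau₂ P : SMat m n S) a b * z := by
    ext a b
    simp [toMat, mul_assoc]
  rw [h, toMat_tau₂, toMat_P, transposeMat_PMat]
  ext a b
  simp only [QMat, Matrix.of_apply, Matrix.scalar_apply, Matrix.diagonal_mul]
  split_ifs
  · rw [neg_one_pow_mul_comm]
  · simp

/-- The defining equation of the contraction, in terms of ordinary matrices. -/
theorem contraction_iff {t s : SIdx m n → SIdx m n → S} {z : S} :
    tau₂ P ⊙ₛ fst t ⊙ₛ tau₂ (snd s) = (fun i j k l => tau₂ P i j k l * z : SMat m n S) ↔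
      QMat m n S * (fstMat t * sndMat (superTranspose s)) = Matrix.scalar _ z * QMat m n S := by
  rw [← toMat_injective.eq_iff, toMat_eq_QMat_mul, toMat_mul, toMat_mul, toMat_tau₂, toMat_tau₂,
    toMat_P, toMat_fst, toMat_snd, transposeMat_PMat, transposeMat_sndMat, mul_assoc]

theorem snd_mul_snd_eq_one {s w : SIdx m n → SIdx m n → S}
    (h : Matrix.of s * Matrix.of w = 1) : snd s ⊙ₛ snd w = (one : SMat m n S) := by
  rw [← toMat_injective.eq_iff, toMat_mul, toMat_snd, toMat_snd, toMat_one, sndMat_mul_eq_one h]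

/-- A left inverse equals a right inverse, so the matrix `Y` in the definition of the contraction is
forced, although it is not assumed to act on the second factor only. -/
theorem eq_snd_of_mul_eq_one {s w : SIdx m n → SIdx m n → S} {Y : SMat m n S}
    (h : Matrix.of s * Matrix.of w = 1) (hY : snd w ⊙ₛ Y = one) : Y = snd s := by
  rw [← toMat_injective.eq_iff, toMat_mul, toMat_snd, toMat_one] at hY
  rw [← toMat_injective.eq_iff, toMat_snd]
  exact (left_inv_eq_right_inv (sndMat_mul_eq_one h) hY).symm

/-- The scalar in the defining equation of the contraction is unique. -/
theorem contraction_unique (hmn : m ≠ n) {z z' : S}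
    (h : (fun i j k l => tau₂ P i j k l * z : SMat m n S) = fun i j k l => tau₂ P i j k l * z') :
    z = z' := by
  have h2 := congrArg toMat h
  rw [toMat_eq_QMat_mul, toMat_eq_QMat_mul] at h2
  -- An index exists because m ≠ n excludes m = n = 0.
  let i : SIdx m n := ⟨0, by omega⟩
  have h3 := congrFun (congrFun h2 (i, i)) (i, i)
  simp only [QMat, Matrix.of_apply, Matrix.scalar_apply, Matrix.diagonal_mul, and_self, if_true]
    at h3
  have h4 := congrArg (· * (-1 : S) ^ par i) h3
  simpa only [mul_assoc, neg_one_pow_mul_self, mul_one] using h4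

/-! ### Change of coefficients -/

variable {S' : Type*} [Ring S']

/-- Apply a ring homomorphism to all coefficients. -/
def mapHom (φ : S →+* S') (X : SMat m n S) : SMat m n S' := fun i j k l => φ (X i j k l)

theorem mapHom_mul (φ : S →+* S') (X Y : SMat m n S) :
    mapHom φ (X ⊙ₛ Y) = mapHom φ X ⊙ₛ mapHom φ Y := by
  funext i j k l
  simp [mapHom, SMat.mul]

theorem mapHom_sub (φ : S →+* S') (X Y : SMat m n S) :
    mapHom φ (X - Y) = mapHom φ X - mapHom φ Y := by
  funext i j k l
  simp [mapHom]

theorem mapHom_one (φ : S →+* S') : mapHom φ (one : SMat m n S) = one := by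
  funext i j k l
  simp only [mapHom, one]
  split_ifs <;> simp

theorem mapHom_P (φ : S →+* S') : mapHom φ (P : SMat m n S) = P := by
  funext i j k l
  simp only [mapHom, P]
  split_ifs <;> simp

theorem mapHom_scale (φ : S →+* S') (s : S) (X : SMat m n S) :
    mapHom φ (scale s X) = scale (φ s) (mapHom φ X) := by
  funext i j k l
  simp [mapHom, scale]

theorem mapHom_fst (φ : S →+* S') (t : SIdx m n → SIdx m n → S) :
    mapHom φ (fst t) = fst fun i j => φ (t i j) := by
  funext i j k l
  simp only [mapHom, fst]
  split_ifs <;> simp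

theorem mapHom_snd (φ : S →+* S') (t : SIdx m n → SIdx m n → S) :
    mapHom φ (snd t) = snd fun i j => φ (t i j) := by
  funext i j k l
  simp only [mapHom, snd]
  split_ifs <;> simp

theorem mapHom_tau₂ (φ : S →+* S') (X : SMat m n S) :
    mapHom φ (tau₂ X) = tau₂ (mapHom φ X) := by
  funext i j k l
  simp [mapHom, tau₂]

theorem mapHom_injective {φ : S →+* S'} (hφ : Function.Injective φ) :
    Function.Injective (mapHom φ : SMat m n S → _) := by
  intro X Y h
  funext i j k l
  exact hφ (congrFun (congrFun (congrFun (congrFun h i) j) k) l)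

end Contraction

end SMat

/-! ## Shifts of convergent power series -/

open PowerSeries in
/-- `h(u) = f(u + a)`, for power series with coefficients in a topological algebra. -/
def HasShift {A : Type*} [Ring A] [Algebra ℂ A] [TopologicalSpace A] (a : ℂ)
    (f h : PowerSeries A) : Prop :=
  ∀ k, HasSum (fun r : ℕ => ((r.choose k : ℂ) * a ^ (r - k)) • coeff r f) (coeff k h)

namespace HasShift

open PowerSeries

variable {A : Type*} [Ring A] [Algebra ℂ A] [TopologicalSpace A] {a : ℂ} {f g h k : PowerSeries A}

theorem unique [T2Space A] (hh : HasShift a f h) (hk : HasShift a f k) : h = k :=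
  PowerSeries.ext fun d => (hh d).unique (hk d)

theorem zero : HasShift a (0 : PowerSeries A) 0 := fun d => by
  simp [hasSum_zero]

theorem map {B : Type*} [Ring B] [Algebra ℂ B] [TopologicalSpace B] (φ : A →ₐ[ℂ] B)
    (hφ : Continuous φ) (hf : HasShift a f h) :
    HasShift a (PowerSeries.map (φ : A →+* B) f) (PowerSeries.map (φ : A →+* B) h) := fun d => by
  have := (hf d).map (φ : A →+* B) hφ
  simp only [coeff_map]
  convert this using 2 with r
  simp

variable [IsTopologicalRing A]

theorem add (hf : HasShift a f h) (hg : HasShift a g k) : HasShift a (f + g) (h + k) := fun d => by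
  simpa only [map_add, smul_add] using (hf d).add (hg d)

theorem neg (hf : HasShift a f h) : HasShift a (-f) (-h) := fun d => by
  simpa only [map_neg, smul_neg] using (hf d).neg

theorem sub (hf : HasShift a f h) (hg : HasShift a g k) : HasShift a (f - g) (h - k) := by
  simpa only [sub_eq_add_neg] using hf.add hg.neg

theorem sum {ι : Type*} {s : Finset ι} {f h : ι → PowerSeries A}
    (H : ∀ i ∈ s, HasShift a (f i) (h i)) : HasShift a (∑ i ∈ s, f i) (∑ i ∈ s, h i) := by
  classical
  induction s using Finset.induction_on with
  | empty => simpa using zero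
  | insert i s hi ih =>
    rw [Finset.sum_insert hi, Finset.sum_insert hi]
    exact (H i (Finset.mem_insert_self i s)).add
      (ih fun j hj => H j (Finset.mem_insert_of_mem hj))

theorem C_mul (c : A) (hf : HasShift a f h) : HasShift a (C c * f) (C c * h) := fun d => by
  simpa only [coeff_C_mul, mul_smul_comm] using (hf d).mul_left c

theorem mul_C (c : A) (hf : HasShift a f h) : HasShift a (f * C c) (h * C c) := fun d => by
  simpa only [coeff_mul_C, smul_mul_assoc] using (hf d).mul_right c

theorem smul (z : ℂ) (hf : HasShift a f h) : HasShift a (z • f) (z • h) := by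
  have := hf.C_mul (algebraMap ℂ A z)
  have e : ∀ f : PowerSeries A, C (algebraMap ℂ A z) * f = z • f := fun f => by
    ext d
    rw [coeff_C_mul, coeff_smul, Algebra.smul_def]
  rwa [e, e] at this

/-- The binomial expansion of (u + a)^{r+1} is reduced to that of (u + a)^r by Pascal's rule. -/
theorem X_mul (hf : HasShift a f h) :
    HasShift a (X * f) ((X + C (algebraMap ℂ A a)) * h) := fun d => by
  -- The series X f has no constant term, so the sum may start at r = 1.
  rw [← hasSum_nat_add_iff' 1]
  simp only [Finset.range_one, Finset.sum_singleton, coeff_succ_X_mul, coeff_zero_X_mul, smul_zero,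
    sub_zero, add_mul, map_add, coeff_C_mul]
  have h2 := (hf d).mul_left (algebraMap ℂ A a)
  cases d with
  | zero =>
    rw [coeff_zero_X_mul, zero_add]
    refine Eq.mp (congrArg (fun g => HasSum g _) (funext fun r => Eq.symm ?_)) h2
    rw [← Algebra.smul_def, smul_smul]
    simp [pow_succ']
  | succ d =>
    rw [coeff_succ_X_mul]
    refine Eq.mp (congrArg (fun g => HasSum g _) (funext fun r => Eq.symm ?_)) ((hf d).add h2)
    rw [← Algebra.smul_def, smul_smul, ← add_smul]
    congr 1
    rw [Nat.choose_succ_succ, show r + 1 - (d + 1) = r - d by omega]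
    -- For r ≤ d the exponent r - (d + 1) is truncated, but the binomial coefficient in front of it
    -- vanishes.
    rcases Nat.lt_or_ge d r with hr | hr
    · obtain ⟨e, rfl⟩ := Nat.exists_eq_add_of_lt hr
      rw [show d + e + 1 - d = e + 1 by omega, show d + e + 1 - (d + 1) = e by omega]
      push_cast
      ring
    · rw [Nat.choose_eq_zero_of_lt (by omega : r < d + 1)]
      simp

theorem sign_mul (e : ℕ) (hf : HasShift a f h) : HasShift a ((-1) ^ e * f) ((-1) ^ e * h) := by
  rcases neg_one_pow_eq_or (PowerSeries A) e with he | he <;> rw [he]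
  · simpa using hf
  · simpa using hf.neg

end HasShift

/-- Multiplication by `p(u)` becomes multiplication by `q(u) = p(u + a)`. -/
def IsShiftMul {A : Type*} [Ring A] [Algebra ℂ A] [TopologicalSpace A] (a : ℂ)
    (p q : PowerSeries A) : Prop :=
  ∀ f h : PowerSeries A, HasShift a f h → HasShift a (p * f) (q * h)

namespace IsShiftMul

open PowerSeries

variable {A : Type*} [Ring A] [Algebra ℂ A] [TopologicalSpace A] {a : ℂ}
  {p q p' q' : PowerSeries A}

theorem one : IsShiftMul a (1 : PowerSeries A) 1 := fun f h hf => by simpa using hf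

theorem mul (hp : IsShiftMul a p q) (hp' : IsShiftMul a p' q') :
    IsShiftMul a (p * p') (q * q') := fun f h hf => by
  rw [mul_assoc, mul_assoc]
  exact hp _ _ (hp' _ _ hf)

theorem pow (hp : IsShiftMul a p q) (k : ℕ) : IsShiftMul a (p ^ k) (q ^ k) := by
  induction k with
  | zero => simpa using one
  | succ k ih =>
    rw [pow_succ, pow_succ]
    exact ih.mul hp

variable [IsTopologicalRing A]

theorem sum {ι : Type*} {s : Finset ι} {p q : ι → PowerSeries A}
    (H : ∀ i ∈ s, IsShiftMul a (p i) (q i)) : IsShiftMul a (∑ i ∈ s, p i) (∑ i ∈ s, q i) :=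
  fun f h hf => by
    rw [Finset.sum_mul, Finset.sum_mul]
    exact HasShift.sum fun i hi => H i hi f h hf

theorem smul (z : ℂ) (hp : IsShiftMul a p q) : IsShiftMul a (z • p) (z • q) := fun f h hf => by
  rw [smul_mul_assoc, smul_mul_assoc]
  exact (hp f h hf).smul z

theorem X_sub_C (c : A) :
    IsShiftMul a (X - C c) (X - C c + C (algebraMap ℂ A a)) := fun f h hf => by
  rw [show X - C c + C (algebraMap ℂ A a) = (X + C (algebraMap ℂ A a)) - C c by abel, sub_mul,
    sub_mul]
  exact hf.X_mul.sub (hf.C_mul c)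

/-- Each coefficient in u⁻¹ of f(u - v + c) is a polynomial in v, so the multiplier can be shifted
algebraically, without any convergence. -/
theorem coeff_shiftInv (f : PowerSeries ℂ) (c : A) (d : ℕ) :
    IsShiftMul a (coeff d (shiftInv f (X - C c)))
      (coeff d (shiftInv f (X - C c + C (algebraMap ℂ A a)))) := by
  rw [shiftInv, shiftInv, coeff_mk, coeff_mk]
  exact sum fun k _ => ((X_sub_C c).pow _).smul _

end IsShiftMul

/-- A shift in the inner of two variables. -/
def HasInnerShift {A : Type*} [Ring A] [Algebra ℂ A] [TopologicalSpace A] (a : ℂ)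
    (f h : PowerSeries (PowerSeries A)) : Prop :=
  ∀ d, HasShift a (PowerSeries.coeff d f) (PowerSeries.coeff d h)

namespace HasInnerShift

open PowerSeries

variable {A : Type*} [Ring A] [Algebra ℂ A] [TopologicalSpace A] {a : ℂ}
  {f g h k : PowerSeries (PowerSeries A)}

theorem unique [T2Space A] (hh : HasInnerShift a f h) (hk : HasInnerShift a f k) : h = k :=
  PowerSeries.ext fun d => (hh d).unique (hk d)

theorem inSnd {w v : PowerSeries A} (hw : HasShift a w v) :
    HasInnerShift a (inSnd w) (inSnd v) := fun d => by
  rw [_root_.inSnd, _root_.inSnd, coeff_C, coeff_C]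
  split_ifs
  · exact hw
  · exact HasShift.zero

variable [IsTopologicalRing A]

theorem sub (hf : HasInnerShift a f h) (hg : HasInnerShift a g k) :
    HasInnerShift a (f - g) (h - k) := fun d => by
  simpa only [map_sub] using (hf d).sub (hg d)

theorem sign_mul (e : ℕ) (hf : HasInnerShift a f h) :
    HasInnerShift a ((-1) ^ e * f) ((-1) ^ e * h) := by
  rcases neg_one_pow_eq_or (PowerSeries (PowerSeries A)) e with he | he <;> rw [he]
  · simpa using hf
  · intro d
    simpa using (hf d).neg

theorem mul_left_of {p q : PowerSeries (PowerSeries A)}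
    (hp : ∀ d, IsShiftMul a (coeff d p) (coeff d q)) (hf : HasInnerShift a f h) :
    HasInnerShift a (p * f) (q * h) := fun d => by
  rw [coeff_mul, coeff_mul]
  exact HasShift.sum fun x _ => hp _ _ _ (hf _)

theorem inFst_mul (t : PowerSeries A) (hf : HasInnerShift a f h) :
    HasInnerShift a (inFst t * f) (inFst t * h) :=
  mul_left_of (fun d f h hf => by
    rw [inFst, coeff_map]
    exact hf.C_mul _) hf

theorem mul_inFst (t : PowerSeries A) (hf : HasInnerShift a f h) :
    HasInnerShift a (f * inFst t) (h * inFst t) := fun d => by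
  rw [coeff_mul, coeff_mul]
  refine HasShift.sum fun x _ => ?_
  rw [inFst, coeff_map]
  exact (hf _).mul_C _

end HasInnerShift

/-! ## The relations of the dual Yangian at shifted arguments -/

namespace SMat

variable {m n : ℕ} {S : Type*} [Ring S]

theorem fstMat_mul_sndMat_apply (t w : SIdx m n → SIdx m n → S) (a b : SIdx m n × SIdx m n) :
    (fstMat t * sndMat w) a b =
      (-1) ^ (par b.1 * (par a.2 + par b.2)) * (t a.1 b.1 * w a.2 b.2) := by
  rw [fstMat_mul_apply, Finset.sum_eq_single b.1]
  · simp [sndMat, neg_one_pow_left_comm]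
  · intro p _ hp
    simp [sndMat, hp]
  · simp

theorem sndMat_mul_fstMat_apply (t w : SIdx m n → SIdx m n → S) (a b : SIdx m n × SIdx m n) :
    (sndMat w * fstMat t) a b =
      (-1) ^ (par a.1 * (par a.2 + par b.2)) * (w a.2 b.2 * t a.1 b.1) := by
  rw [mul_fstMat_apply, Finset.sum_eq_single a.1]
  · simp [sndMat, mul_assoc]
  · intro p _ hp
    simp [sndMat, hp.symm]
  · simp

/-- The entries of a relation `(c - d P) A = B (c' - d' P)`. -/
theorem scalar_sub_PMat_mul_apply {c d : S}
    (A : Matrix (SIdx m n × SIdx m n) (SIdx m n × SIdx m n) S) (a b : SIdx m n × SIdx m n) :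
    ((Matrix.scalar _ c * 1 - Matrix.scalar _ d * PMat m n S) * A
       : Matrix (SIdx m n × SIdx m n) (SIdx m n × SIdx m n) S) a b =
      c * A a b - d * ((-1) ^ (par a.1 * par a.2) * A (a.2, a.1) b) := by
  rw [sub_mul, mul_one, mul_assoc, Matrix.sub_apply, Matrix.scalar_apply, Matrix.scalar_apply,
    Matrix.diagonal_mul, Matrix.diagonal_mul, PMat_mul_apply]

theorem mul_scalar_sub_PMat_apply {c d : S} (hc : ∀ x : S, c * x = x * c)
    (hd : ∀ x : S, d * x = x * d)
    (A : Matrix (SIdx m n × SIdx m n) (SIdx m n × SIdx m n) S) (a b : SIdx m n × SIdx m n) :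
    (A * (Matrix.scalar _ c * 1 - Matrix.scalar _ d * PMat m n S)
       : Matrix (SIdx m n × SIdx m n) (SIdx m n × SIdx m n) S) a b =
      c * A a b - d * ((-1) ^ (par b.1 * par b.2) * A a (b.2, b.1)) := by
  have h : Matrix.scalar _ d * PMat m n S = PMat m n S * Matrix.scalar _ d := by
    ext a b
    simp [Matrix.diagonal_mul, Matrix.mul_diagonal, hd]
  rw [mul_sub, mul_one, h, ← mul_assoc, Matrix.sub_apply, Matrix.scalar_apply, Matrix.scalar_apply,
    Matrix.mul_diagonal, Matrix.mul_diagonal, mul_PMat_apply, ← hc, ← hd, neg_one_pow_mul_comm]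

end SMat

/-! ### Restriction of two-variable series to u = v -/

section Diagonal

open PowerSeries

variable {A : Type*} [Ring A]

/-- The series `f(u, u)`. -/
noncomputable def diag (f : PowerSeries (PowerSeries A)) : PowerSeries A :=
  mk fun k => ∑ x ∈ Finset.HasAntidiagonal.antidiagonal k, coeff₂ x.1 x.2 f

theorem diag_sub (f g : PowerSeries (PowerSeries A)) : diag (f - g) = diag f - diag g := by
  ext d
  simp [diag, coeff₂]

theorem diag_sign_mul (e : ℕ) (f : PowerSeries (PowerSeries A)) :
    diag ((-1) ^ e * f) = (-1) ^ e * diag f := by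
  rcases Nat.even_or_odd e with h | h
  · simp [h.neg_one_pow]
  · simp only [h.neg_one_pow, neg_one_mul]
    have := diag_sub 0 f
    have h0 : diag (0 : PowerSeries (PowerSeries A)) = 0 := by
      simpa using diag_sub (0 : PowerSeries (PowerSeries A)) 0
    simpa [h0] using this

theorem diag_smul [Algebra ℂ A] (z : ℂ) (f : PowerSeries (PowerSeries A)) :
    diag (z • f) = z • diag f := by
  ext d
  simp [diag, coeff₂, Finset.smul_sum]

theorem diag_inFst_mul_inSnd (f g : PowerSeries A) : diag (inFst f * inSnd g) = f * g := by
  ext d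
  simp [diag, DY.coeff₂_inFst_mul_inSnd, coeff_mul]

theorem diag_inSnd_mul_inFst (f g : PowerSeries A) : diag (inSnd g * inFst f) = g * f := by
  ext d
  rw [diag, coeff_mk, coeff_mul, ← Finset.Nat.sum_antidiagonal_swap]
  simp [DY.coeff₂_inSnd_mul_inFst]

/-- Together with `diag_C_X_mul` this shows that multiples of u - v vanish on the diagonal. -/
theorem diag_X_mul (f : PowerSeries (PowerSeries A)) : diag (X * f) = X * diag f := by
  ext d
  cases d with
  | zero => simp [diag, coeff₂]
  | succ d =>
    rw [coeff_succ_X_mul, diag, diag, coeff_mk, coeff_mk, Finset.Nat.sum_antidiagonal_succ]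
    simp [coeff₂]

theorem diag_C_X_mul (f : PowerSeries (PowerSeries A)) : diag (C X * f) = X * diag f := by
  ext d
  cases d with
  | zero => simp [diag, coeff₂]
  | succ d =>
    rw [coeff_succ_X_mul, diag, diag, coeff_mk, coeff_mk, Finset.Nat.sum_antidiagonal_succ']
    simp [coeff₂]

theorem inFst_X : (inFst X : PowerSeries (PowerSeries A)) = X := by
  simp [inFst]

end Diagonal

/-! ### The dual relation specialized to u = v + m - n -/

section Dual

open PowerSeries SMat

variable {m n : ℕ} {E : Type*} [Ring E] [Algebra ℂ E] [TopologicalSpace E]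

open scoped PowerSeries.WithPiTopology in
theorem HasShift.inFst {a : ℂ} {f h : PowerSeries E} (hf : HasShift a f h) :
    HasShift a (inFst f) (inFst h) := by
  let φ : E →ₐ[ℂ] PowerSeries E :=
    { (C : E →+* PowerSeries E) with
      commutes' := fun z => (PowerSeries.algebraMap_apply).symm }
  exact hf.map φ WithPiTopology.continuous_C

variable [IsTopologicalRing E] [T2Space E]

open scoped PowerSeries.WithPiTopology in
/-- The relations of the dual Yangian at `u = v + m - n`. -/
theorem dual_relation_shift {w W : SIdx m n → SIdx m n → PowerSeries E}
    (hw : RDual m n E ⊙ₛ fst (fun i j => inFst (w i j)) ⊙ₛ snd (fun i j => inSnd (w i j)) =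
      snd (fun i j => inSnd (w i j)) ⊙ₛ fst (fun i j => inFst (w i j)) ⊙ₛ RDual m n E)
    (hW : ∀ i j, HasShift ((m : ℂ) - n) (w i j) (W i j)) :
    (((m : ℂ) - n) • 1 - PMat m n (PowerSeries E)) * (fstMat W * sndMat w) =
      sndMat w * fstMat W * (((m : ℂ) - n) • 1 - PMat m n (PowerSeries E)) := by
  set N := (m : ℂ) - n
  set c : PowerSeries (PowerSeries E) := X - C X with hc
  have hcc : ∀ x : PowerSeries (PowerSeries E), c * x = x * c := fun x => by
    rw [hc, sub_mul, mul_sub, X_mul]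
    congr 1
    ext1 d
    rw [coeff_C_mul, coeff_mul_C, X_mul]
  have hR : toMat (RDual m n E) =
      Matrix.scalar _ c * 1 - Matrix.scalar _ 1 * PMat m n (PowerSeries (PowerSeries E)) := by
    rw [RDual, toMat_sub, inFst_X, inSnd, toMat_scale _ hcc, toMat_one, toMat_P, map_one, one_mul]
  have h := congrArg toMat hw
  simp only [toMat_mul, hR, toMat_fst, toMat_snd] at h
  -- Shifting the outer variable u by N replaces the factor u - v by u - v + N and leaves P
  -- unchanged.
  have hshift : ∀ e, ∀ f g f' g' : PowerSeries (PowerSeries E), HasShift N f f' →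
      HasShift N g g' → HasShift N (c * f - 1 * ((-1) ^ e * g))
        ((c + C (algebraMap ℂ _ N)) * f' - (-1) ^ e * g') := by
    intro e f g f' g' hf hg
    rw [one_mul, hc, sub_mul,
      show (X - C X + C (algebraMap ℂ _ N)) * f' =
        (X + C (algebraMap ℂ (PowerSeries E) N)) * f' - C X * f' by
        rw [sub_add_eq_add_sub, sub_mul]]
    exact (hf.X_mul.sub (hf.C_mul _)).sub (hg.sign_mul e)
  have hA : ∀ a b, HasShift N
      ((fstMat (fun i j => inFst (w i j)) * sndMat fun i j => inSnd (w i j)) a b)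
      ((fstMat (fun i j => inFst (W i j)) * sndMat fun i j => inSnd (w i j)) a b) := fun a b => by
    rw [fstMat_mul_sndMat_apply, fstMat_mul_sndMat_apply]
    exact ((hW _ _).inFst.mul_C _).sign_mul _
  have hB : ∀ a b, HasShift N
      ((sndMat (fun i j => inSnd (w i j)) * fstMat fun i j => inFst (w i j)) a b)
      ((sndMat (fun i j => inSnd (w i j)) * fstMat fun i j => inFst (W i j)) a b) := fun a b => by
    rw [sndMat_mul_fstMat_apply, sndMat_mul_fstMat_apply]
    exact ((hW _ _).inFst.C_mul _).sign_mul _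
  -- On the diagonal u - v + N becomes the scalar N.
  have hdiag : ∀ e, ∀ f g : PowerSeries (PowerSeries E),
      diag ((c + C (algebraMap ℂ _ N)) * f - (-1) ^ e * g) = N • diag f - (-1) ^ e * diag g := by
    intro e f g
    have : C (algebraMap ℂ (PowerSeries E) N) * f = N • f := by
      ext1 d
      rw [coeff_C_mul, coeff_smul, Algebra.smul_def]
    rw [diag_sub, diag_sign_mul, hc, add_mul, sub_mul, this, add_comm, add_sub,
      diag_sub, ← diag_smul, diag_C_X_mul, ← diag_X_mul, ← diag_sub, add_sub_cancel_right]
  ext1 a b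
  have hab := congrFun (congrFun h a) b
  rw [mul_assoc, scalar_sub_PMat_mul_apply, mul_scalar_sub_PMat_apply hcc (by simp)] at hab
  have h1 := hshift (par a.1 * par a.2) _ _ _ _ (hA a b) (hA (a.2, a.1) b)
  have h2 := hshift (par b.1 * par b.2) _ _ _ _ (hB a b) (hB a (b.2, b.1))
  rw [hab] at h1
  -- Both sides of the relation are shifts of one series, so they agree by uniqueness of limits.
  -- Setting u = v then leaves series in one variable.
  have h3 := congrArg diag (h1.unique h2)
  rw [hdiag, hdiag] at h3
  simp only [fstMat_mul_sndMat_apply, sndMat_mul_fstMat_apply, diag_sign_mul,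
    diag_inFst_mul_inSnd, diag_inSnd_mul_inFst] at h3
  rw [sub_mul, mul_sub, smul_mul_assoc, mul_smul_comm, one_mul, mul_one, Matrix.sub_apply,
    Matrix.sub_apply, Matrix.smul_apply, Matrix.smul_apply, PMat_mul_apply, mul_PMat_apply,
    neg_one_pow_mul_comm]
  simpa only [fstMat_mul_sndMat_apply, sndMat_mul_fstMat_apply] using h3

end Dual

/-! ## The mixed relations -/

section Mixed

open PowerSeries SMat

variable {A : Type*} [Ring A]

theorem map_mul_comm_of_central {B : Type*} [Ring B] (φ : B →+* A)
    (hφ : ∀ b a, φ b * a = a * φ b) (f : PowerSeries B) (g : PowerSeries A) :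
    PowerSeries.map φ f * g = g * PowerSeries.map φ f := by
  ext d
  rw [coeff_mul, coeff_mul, ← Finset.Nat.sum_antidiagonal_swap]
  simp [hφ]

variable [Algebra ℂ A] {K : Type*} [CommRing K] [Algebra ℂ K] (φ : K →ₐ[ℂ] A)

/-- The extension of a homomorphism to series in two variables. -/
noncomputable def seriesMap : PowerSeries (PowerSeries K) →+* PowerSeries (PowerSeries A) :=
  PowerSeries.map (PowerSeries.map (φ : K →+* A))

variable {φ}

theorem seriesMap_mul_comm (hφ : ∀ k a, φ k * a = a * φ k) (z : PowerSeries (PowerSeries K))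
    (x : PowerSeries (PowerSeries A)) : seriesMap φ z * x = x * seriesMap φ z :=
  map_mul_comm_of_central _ (map_mul_comm_of_central _ hφ) z x

/-- Series with coefficients in `A` form an algebra over those with central coefficients. -/
noncomputable abbrev seriesAlgebra (hφ : ∀ k a, φ k * a = a * φ k) :
    Algebra (PowerSeries (PowerSeries K)) (PowerSeries (PowerSeries A)) :=
  (seriesMap φ).toAlgebra' (seriesMap_mul_comm hφ)

theorem seriesMap_shiftInv (f : PowerSeries ℂ) (a : PowerSeries K) :
    seriesMap φ (shiftInv f a) = shiftInv f (PowerSeries.map (φ : K →+* A) a) :=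
  map_shiftInv (PowerSeries.mapAlgHom φ) f a

theorem mapHom_RMixed {m n : ℕ} {B : Type*} [Ring B] [Algebra ℂ B] (φ : B →ₐ[ℂ] A) (e : B) :
    mapHom (PowerSeries.map (PowerSeries.map (φ : B →+* A))) (RMixed m n B e) =
      RMixed m n A (φ e) := by
  have h : ∀ f : PowerSeries ℂ, PowerSeries.map (PowerSeries.map (φ : B →+* A))
      (shiftInv f (X - C e)) = shiftInv f (X - C (φ e)) := fun f => by
    have := map_shiftInv (PowerSeries.mapAlgHom φ) f (X - C e)
    refine this.trans (congrArg _ ?_)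
    change PowerSeries.map (φ : B →+* A) (X - C e) = _
    simp
  rw [RMixed, RMixed, Rbar, Rbar, mapHom_sub, mapHom_scale, mapHom_scale, mapHom_one, mapHom_P, h,
    h]

variable {m n : ℕ}

/-- Writes the normalized R-matrix as g · (1 - xP) with g and x in a commutative ring of central
series, as the abstract exchange argument requires. -/
theorem toMat_RMixed (hφ : ∀ k a, φ k * a = a * φ k) (e : K) :
    letI := seriesAlgebra hφ
    toMat (RMixed m n A (φ e)) =
      (shiftInv (gSeries ((m : ℂ) - n)) (X - C e) • (1 - invLinear (X - C e) • PMat m n _) :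
        Matrix _ _ (PowerSeries (PowerSeries A))) := by
  let := seriesAlgebra hφ
  have hs : ∀ f : PowerSeries ℂ, shiftInv f (X - C (φ e)) =
      seriesMap φ (shiftInv f (X - C e)) := fun f => by
    rw [seriesMap_shiftInv, map_sub, map_X, map_C]
    rfl
  rw [RMixed, Rbar, hs, hs, toMat_sub, toMat_scale _ (seriesMap_mul_comm hφ _),
    toMat_scale _ (seriesMap_mul_comm hφ _), toMat_one, toMat_P, shiftInv_mul, shiftInv_X,
    smul_sub, smul_smul, mul_comm (invLinear _)]
  congr 1
  · ext a b
    rw [Matrix.scalar_apply, Matrix.diagonal_mul, Matrix.smul_apply, Algebra.smul_def]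
    rfl
  · ext a b
    rw [Matrix.scalar_apply, Matrix.diagonal_mul, Matrix.smul_apply, Algebra.smul_def]
    rfl

variable [TopologicalSpace A] [IsTopologicalRing A] [T2Space A]

/-- The mixed relations with a shift in the argument of the second series. -/
theorem mixed_relation_shift (hφ : ∀ k a, φ k * a = a * φ k) {N : ℂ} {e e' : K}
    {t w W : SIdx m n → SIdx m n → PowerSeries A} (hW : ∀ i j, HasShift N (w i j) (W i j))
    {f f' h h' : PowerSeries ℂ} :
    letI := seriesAlgebra hφ
    ((shiftInv f (X - C e) • 1 - shiftInv f' (X - C e) • PMat m n (PowerSeries (PowerSeries A))) *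
      (fstMat (fun i j => inFst (t i j)) * sndMat fun i j => inSnd (w i j)) =
    (sndMat fun i j => inSnd (w i j)) * fstMat (fun i j => inFst (t i j)) *
      (shiftInv h (X - C e') • 1 - shiftInv h' (X - C e') • PMat m n _)) →
    (shiftInv f (X - C e + algebraMap ℂ _ N) • 1 -
      shiftInv f' (X - C e + algebraMap ℂ _ N) • PMat m n (PowerSeries (PowerSeries A))) *
      (fstMat (fun i j => inFst (t i j)) * sndMat fun i j => inSnd (W i j)) =
    (sndMat fun i j => inSnd (W i j)) * fstMat (fun i j => inFst (t i j)) *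
      (shiftInv h (X - C e' + algebraMap ℂ _ N) • 1 -
        shiftInv h' (X - C e' + algebraMap ℂ _ N) • PMat m n _) := by
  let := seriesAlgebra hφ
  intro hrel
  -- Shifting the inner variable v by N only changes the argument of the central factor.
  have hmul : ∀ (e : K) (f : PowerSeries ℂ) (x y : PowerSeries (PowerSeries A)),
      HasInnerShift N x y → HasInnerShift N (shiftInv f (X - C e) • x)
        (shiftInv f (X - C e + algebraMap ℂ _ N) • y) := by
    intro e f x y hxy
    rw [Algebra.smul_def, Algebra.smul_def]
    change HasInnerShift N (seriesMap φ _ * x) (seriesMap φ _ * y)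
    rw [seriesMap_shiftInv, seriesMap_shiftInv, map_add, map_sub, map_X, map_C,
      PowerSeries.algebraMap_apply, map_C,
      show (φ : K →+* A) (algebraMap ℂ K N) = algebraMap ℂ A N from φ.commutes N]
    exact HasInnerShift.mul_left_of (fun d => IsShiftMul.coeff_shiftInv f _ d) hxy
  have hL : ∀ (e : K) (f f' : PowerSeries ℂ) (k : ℕ)
      (x y x' y' : PowerSeries (PowerSeries A)), HasInnerShift N x y → HasInnerShift N x' y' →
      HasInnerShift N (shiftInv f (X - C e) • x - shiftInv f' (X - C e) • ((-1) ^ k * x'))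
        (shiftInv f (X - C e + algebraMap ℂ _ N) • y -
          shiftInv f' (X - C e + algebraMap ℂ _ N) • ((-1) ^ k * y')) :=
    fun e f f' k x y x' y' hx hx' => (hmul e f _ _ hx).sub (hmul e f' _ _ (hx'.sign_mul k))
  have hA : ∀ a b, HasInnerShift N
      ((fstMat (fun i j => inFst (t i j)) * sndMat fun i j => inSnd (w i j)) a b)
      ((fstMat (fun i j => inFst (t i j)) * sndMat fun i j => inSnd (W i j)) a b) := fun a b => by
    rw [fstMat_mul_sndMat_apply, fstMat_mul_sndMat_apply]
    exact ((HasInnerShift.inSnd (hW _ _)).inFst_mul _).sign_mul _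
  have hB : ∀ a b, HasInnerShift N
      (((sndMat fun i j => inSnd (w i j)) * fstMat fun i j => inFst (t i j)) a b)
      (((sndMat fun i j => inSnd (W i j)) * fstMat fun i j => inFst (t i j)) a b) := fun a b => by
    rw [sndMat_mul_fstMat_apply, sndMat_mul_fstMat_apply]
    exact ((HasInnerShift.inSnd (hW _ _)).mul_inFst _).sign_mul _
  ext1 a b
  have hab := congrFun (congrFun hrel a) b
  simp only [sub_mul, mul_sub, smul_mul_assoc, mul_smul_comm, one_mul, mul_one, Matrix.sub_apply,
    Matrix.smul_apply, PMat_mul_apply _ a b, mul_PMat_apply _ a b, neg_one_pow_mul_comm] at hab ⊢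
  have h1 := hL e f f' (par a.1 * par a.2) _ _ _ _ (hA a b) (hA (a.2, a.1) b)
  have h2 := hL e' h h' (par b.1 * par b.2) _ _ _ _ (hB a b) (hB a (b.2, b.1))
  rw [hab] at h1
  exact h1.unique h2

end Mixed

/-! ## The contraction commutes with `T(u)` -/

section ContractionComm

open PowerSeries SMat

namespace SMat

variable {m n : ℕ} {S S' : Type*} [Ring S] [Ring S']

theorem mapHom_contraction (φ : S →+* S') (z : S) :
    mapHom φ (fun i j k l => tau₂ P i j k l * z : SMat m n S) =
      fun i j k l => tau₂ P i j k l * φ z := by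
  funext i j k l
  have : φ (tau₂ P i j k l) = tau₂ P i j k l := by
    change mapHom φ (tau₂ P) i j k l = _
    rw [mapHom_tau₂, mapHom_P]
  simp only [mapHom, map_mul, this]

theorem mapHom_contraction_lhs (φ : S →+* S') (t s : SIdx m n → SIdx m n → S) :
    mapHom φ (tau₂ P ⊙ₛ fst t ⊙ₛ tau₂ (snd s)) =
      tau₂ P ⊙ₛ fst (fun i j => φ (t i j)) ⊙ₛ tau₂ (snd fun i j => φ (s i j)) := by
  simp only [mapHom_mul, mapHom_tau₂, mapHom_P, mapHom_fst, mapHom_snd]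

theorem of_mul_of_map (φ : S →+* S') {s w : SIdx m n → SIdx m n → S}
    (h : Matrix.of s * Matrix.of w = 1) :
    Matrix.of (fun i j => φ (s i j)) * Matrix.of (fun i j => φ (w i j)) = 1 := by
  have := congrArg φ.mapMatrix h
  rw [map_mul, map_one] at this
  exact this

end SMat

variable {A : Type*} [Ring A] [Algebra ℂ A] [TopologicalSpace A] [IsTopologicalRing A] [T2Space A]
  {m n : ℕ}

/-- If `w` has mixed exchange relations with `t`, then the contraction of `w` commutes with `t`. -/
theorem inFst_mul_inSnd_contraction (hmn : m ≠ n) {K : Type*} [CommRing K] [Algebra ℂ K]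
    {φ : K →ₐ[ℂ] A} (hφ : ∀ k a, φ k * a = a * φ k) (e : K)
    {t s w W : SIdx m n → SIdx m n → PowerSeries A} {z : PowerSeries A}
    (hrel : RMixed m n A (φ e) ⊙ₛ fst (fun i j => inFst (t i j)) ⊙ₛ
        snd (fun i j => inSnd (w i j)) =
      snd (fun i j => inSnd (w i j)) ⊙ₛ fst (fun i j => inFst (t i j)) ⊙ₛ RMixed m n A (-φ e))
    (hW : ∀ i j, HasShift ((m : ℂ) - n) (w i j) (W i j))
    (hsw : Matrix.of s * Matrix.of w = 1) (hws : Matrix.of w * Matrix.of s = 1)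
    (hz : tau₂ P ⊙ₛ fst W ⊙ₛ tau₂ (snd s) =
      (fun i j k l => tau₂ P i j k l * z : SMat m n (PowerSeries A))) (i j : SIdx m n) :
    inFst (t i j) * inSnd z = inSnd z * inFst (t i j) := by
  let := seriesAlgebra hφ
  have hN : (m : ℂ) - n ≠ 0 := sub_ne_zero.2 (by exact_mod_cast hmn)
  have hrel' := congrArg toMat hrel
  rw [← map_neg] at hrel'
  simp only [toMat_mul, toMat_RMixed hφ, toMat_fst, toMat_snd, smul_sub, smul_smul] at hrel'
  rw [mul_assoc] at hrel'
  -- The transposed relation is taken at the unshifted argument v, where the inverse of T⁺ stands.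
  have h2 := transpose_exchange (of_mul_of_map (C : PowerSeries A →+* _) hsw)
    (of_mul_of_map (C : PowerSeries A →+* _) hws) hrel'
  have hz' := congrArg (mapHom (C : PowerSeries A →+* _)) hz
  rw [mapHom_contraction_lhs, mapHom_contraction, contraction_iff] at hz'
  -- The product g(w) w⁻¹ is rewritten as one shifted series so that the shift lemma applies, and is
  -- split again afterwards.
  have hX : ∀ a : PowerSeries K,
      shiftInv (gSeries ((m : ℂ) - n)) a * invLinear a =
        shiftInv (gSeries ((m : ℂ) - n) * X) a := fun a => by
    rw [← shiftInv_X]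
    exact (shiftInv_mul _ _ _).symm
  rw [hX, hX] at hrel'
  have h1 := mixed_relation_shift hφ hW hrel'
  rw [← hX, ← hX] at h1
  simp only [← smul_smul, ← smul_sub] at h1 h2
  -- The arguments in `h1` and `h2` differ by m - n, so the functional equation of g and the
  -- resolvent identity supply the crossing conditions.
  exact contraction_comm (t := fun i j => inFst (t i j)) (w := fun i j => inSnd (W i j))
    (z := inSnd z) h1 h2 hz' (shiftInv_gSeries _ hN _) (shiftInv_gSeries _ hN _)
    (invLinear_eq_sub_natCast m n _) (invLinear_eq_sub_natCast m n _)
    (isUnit_shiftInv_gSeries _ _) (isUnit_shiftInv_gSeries _ _) i j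

end ContractionComm

/-! ## Convergence in the extended dual Yangian -/

namespace DY

variable {m n : ℕ}

theorem dualFiltration_mul_le (p q : ℕ) :
    dualFiltration m n p * dualFiltration m n q ≤ dualFiltration m n (p + q) := by
  rw [dualFiltration, dualFiltration, Submodule.span_mul_span]
  refine Submodule.span_mono ?_
  rintro _ ⟨_, ⟨L, hL, rfl⟩, _, ⟨L', hL', rfl⟩, rfl⟩
  exact ⟨L ++ L', by simp only [List.map_append, List.sum_append]; omega, by simp⟩

theorem dualFiltration_anti {p q : ℕ} (h : p ≤ q) : dualFiltration m n q ≤ dualFiltration m n p :=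
  Submodule.span_mono fun _ ⟨L, hL, hx⟩ => ⟨L, h.trans hL, hx⟩

theorem one_mem_dualFiltration : (1 : DY m n) ∈ dualFiltration m n 0 :=
  Submodule.subset_span ⟨[], Nat.zero_le _, rfl⟩

theorem tNeg_mem_dualFiltration (r : ℕ) (i j : SIdx m n) :
    tNeg r i j ∈ dualFiltration m n (r + 1) :=
  Submodule.subset_span ⟨[(r, i, j)], by simp, by simp⟩

theorem dualFiltration_le_nbhd (p : ℕ) : dualFiltration m n p ≤ nbhd m n p := fun x hx => by
  have := Submodule.mul_mem_mul hx (Submodule.mem_top (x := (1 : DY m n)) (R := ℂ))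
  rwa [mul_one] at this

instance : NonarchimedeanRing (DY m n) := (ringSubgroupsBasis m n).nonarchimedean

open Filter Topology in
theorem tendsto_zero_of_mem_dualFiltration {y : ℕ → DY m n}
    (hy : ∀ k, y k ∈ dualFiltration m n k) : Tendsto y cofinite (𝓝 0) := by
  rw [Nat.cofinite_eq_atTop, (ringSubgroupsBasis m n).hasBasis_nhds_zero.tendsto_right_iff]
  intro p _
  filter_upwards [eventually_ge_atTop p] with k hk
  exact nbhd_anti hk (dualFiltration_le_nbhd k (hy k))

end DY

namespace DYHat

variable (m n : ℕ)

/-- The canonical homomorphism to the completion. -/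
noncomputable def ofDY : DY m n →ₐ[ℂ] DYHat m n :=
  { (UniformSpace.Completion.coeRingHom : DY m n →+* DYHat m n) with
    commutes' := fun _ => rfl }

theorem ofDY_apply (x : DY m n) : ofDY m n x = (x : DYHat m n) := rfl

/-- The part of degree at least `p` of the extended dual Yangian. -/
noncomputable def dualPart (p : ℕ) : Submodule ℂ (extDual m n) :=
  ((DY.dualFiltration m n p).map (ofDY m n).toLinearMap).comap (extDual m n).val.toLinearMap

variable {m n}

theorem mul_mem_dualPart {p q : ℕ} {x y : extDual m n} (hx : x ∈ dualPart m n p)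
    (hy : y ∈ dualPart m n q) : x * y ∈ dualPart m n (p + q) := by
  obtain ⟨a, ha, ha'⟩ := hx
  obtain ⟨b, hb, hb'⟩ := hy
  refine ⟨a * b, DY.dualFiltration_mul_le p q (Submodule.mul_mem_mul ha hb), ?_⟩
  simp only [AlgHom.toLinearMap_apply, map_mul] at ha' hb' ⊢
  rw [ha', hb']

theorem dualPart_anti {p q : ℕ} (h : p ≤ q) : dualPart m n q ≤ dualPart m n p :=
  Submodule.comap_mono (Submodule.map_mono (DY.dualFiltration_anti h))

theorem one_mem_dualPart : (1 : extDual m n) ∈ dualPart m n 0 :=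
  ⟨1, DY.one_mem_dualFiltration, by simp⟩

theorem tNeg_mem_dualPart (r : ℕ) (i j : SIdx m n) : tNeg r i j ∈ dualPart m n (r + 1) :=
  ⟨DY.tNeg r i j, DY.tNeg_mem_dualFiltration r i j, rfl⟩

instance : IsTopologicalRing (extDual m n) :=
  inferInstanceAs (IsTopologicalRing (extDual m n).toSubring)

instance : CompleteSpace (extDual m n) :=
  (Subalgebra.isClosed_topologicalClosure _).completeSpace_coe

/-- In a nonarchimedean group terms tending to zero have Cauchy partial sums. The terms are lifted
to `DY`, where the neighbourhood basis is explicit, and the Cauchy property is carried to the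
closed, hence complete, `extDual`. -/
theorem summable_of_mem_dualPart {x : ℕ → extDual m n} (hx : ∀ k, x k ∈ dualPart m n k) :
    Summable x := by
  choose y hy hyx using hx
  have h := NonarchimedeanAddGroup.cauchySeq_sum_of_tendsto_cofinite_zero
    (DY.tendsto_zero_of_mem_dualFiltration hy)
  have h2 := h.map (UniformSpace.Completion.uniformContinuous_coe (DY m n))
  rw [summable_iff_cauchySeq_finset]
  have hval : IsUniformInducing ((↑) : extDual m n → DYHat m n) := isUniformInducing_val _
  refine (hval.cauchy_map_iff).1 ?_
  rw [Filter.map_map] at h2 ⊢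
  convert h2 using 2
  funext s
  simp only [Function.comp_apply]
  rw [AddSubmonoidClass.coe_finsetSum, ← ofDY_apply, map_sum]
  exact Finset.sum_congr rfl fun k _ => (hyx k).symm

/-- The series `T⁺(u)` can be shifted. -/
theorem exists_shift (a : ℂ) (i j : SIdx m n) :
    ∃ h : PowerSeries (extDual m n), HasShift a (tPlus i j) h := by
  -- The coefficient of u^r has degree r + 1, apart from the constant δ_{ij} at r = 0, so degree at
  -- least r always holds.
  have hmem : ∀ r, PowerSeries.coeff r (tPlus (m := m) (n := n) i j) ∈ dualPart m n r := by
    intro r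
    rw [tPlus, tPlusSeries, map_sub, PowerSeries.coeff_mk]
    refine sub_mem ?_ (dualPart_anti (Nat.le_succ r) (tNeg_mem_dualPart r i j))
    by_cases hij : i = j
    · rw [if_pos hij, PowerSeries.coeff_one]
      split_ifs with hr
      · rw [hr]
        exact one_mem_dualPart
      · exact zero_mem _
    · rw [if_neg hij, map_zero]
      exact zero_mem _
  refine ⟨PowerSeries.mk fun k => ∑' r : ℕ, ((r.choose k : ℂ) * a ^ (r - k)) •
    PowerSeries.coeff r (tPlus i j), fun k => ?_⟩
  rw [PowerSeries.coeff_mk]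
  exact (summable_of_mem_dualPart fun r => Submodule.smul_mem _ _ (hmem r)).hasSum

open scoped PowerSeries.WithPiTopology in
/-- The matrix `T⁺(u)` is invertible. -/
theorem exists_inverse : ∃ s : SIdx m n → SIdx m n → PowerSeries (extDual m n),
    Matrix.of s * Matrix.of tPlus = 1 ∧ Matrix.of tPlus * Matrix.of s = 1 := by
  set A : Matrix (SIdx m n) (SIdx m n) (PowerSeries (extDual m n)) :=
    Matrix.of fun i j => PowerSeries.mk fun r => tNeg r i j with hA
  have hT : Matrix.of tPlus = 1 - A := by
    ext1 i j
    rw [Matrix.sub_apply, Matrix.one_apply]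
    rfl
  -- Every entry of A has coefficients of degree at least 1, uniformly in the power of u. The
  -- geometric series of A therefore converges coefficient by coefficient.
  have hmem : ∀ k i j d, PowerSeries.coeff d ((A ^ k) i j) ∈ dualPart m n k := by
    intro k
    induction k with
    | zero =>
      intro i j d
      rw [pow_zero, Matrix.one_apply]
      by_cases hij : i = j
      · rw [if_pos hij, PowerSeries.coeff_one]
        split_ifs
        · exact one_mem_dualPart
        · exact zero_mem _
      · rw [if_neg hij, map_zero]
        exact zero_mem _
    | succ k ih =>
      intro i j d
      rw [pow_succ, Matrix.mul_apply, map_sum]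
      refine sum_mem fun p _ => ?_
      rw [PowerSeries.coeff_mul]
      refine sum_mem fun x _ => mul_mem_dualPart (ih _ _ _) ?_
      rw [hA, Matrix.of_apply, PowerSeries.coeff_mk]
      exact dualPart_anti (by omega) (tNeg_mem_dualPart x.2 p j)
  have hsum : Summable fun k => A ^ k := by
    refine Pi.summable.2 fun i => Pi.summable.2 fun j => ?_
    rw [PowerSeries.WithPiTopology.summable_iff_summable_coeff]
    exact fun d => summable_of_mem_dualPart fun k => hmem k i j d
  refine ⟨∑' k, A ^ k, ?_, ?_⟩
  · rw [hT]
    exact hsum.tsum_pow_mul_one_sub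
  · rw [hT]
    exact hsum.one_sub_mul_tsum_pow

end DYHat

/-! ## The defining relations in the completion -/

namespace DYHat

open PowerSeries SMat

variable {m n : ℕ}

variable (m n) in
/-- The canonical homomorphism from the free algebra to the completion of the double Yangian. -/
noncomputable def ofFree : DYFree m n →ₐ[ℂ] DYHat m n := (ofDY m n).comp (DY.proj m n)

/-- The extension of a ring homomorphism to series in two variables. -/
noncomputable abbrev map₂ {A B : Type*} [Ring A] [Ring B] (φ : A →+* B) :
    PowerSeries (PowerSeries A) →+* PowerSeries (PowerSeries B) :=
  PowerSeries.map (PowerSeries.map φ)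

theorem coeff₂_map₂ {A B : Type*} [Ring A] [Ring B] (φ : A →+* B)
    (f : PowerSeries (PowerSeries A)) (a b : ℕ) : coeff₂ a b (map₂ φ f) = φ (coeff₂ a b f) := by
  simp [coeff₂]

theorem map₂_inFst {A B : Type*} [Ring A] [Ring B] (φ : A →+* B) (f : PowerSeries A) :
    map₂ φ (inFst f) = inFst (PowerSeries.map φ f) := by
  ext d
  simp [inFst, map₂]

theorem map₂_inSnd {A B : Type*} [Ring A] [Ring B] (φ : A →+* B) (f : PowerSeries A) :
    map₂ φ (inSnd f) = inSnd (PowerSeries.map φ f) := by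
  simp [inSnd, map₂]

theorem map₂_injective {A B : Type*} [Ring A] [Ring B] {φ : A →+* B}
    (hφ : Function.Injective φ) : Function.Injective (map₂ φ) :=
  PowerSeries.map_injective _ (PowerSeries.map_injective _ hφ)

theorem mapHom_eq_of_rel {X Y : SMat m n (PowerSeries (PowerSeries (DYFree m n)))}
    (h : ∀ i j k l a b, DYRel m n (coeff₂ a b (X i j k l)) (coeff₂ a b (Y i j k l))) :
    mapHom (map₂ (ofFree m n : DYFree m n →+* DYHat m n)) X =
      mapHom (map₂ (ofFree m n : DYFree m n →+* DYHat m n)) Y := by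
  funext i j k l
  ext a b
  change coeff₂ a b _ = coeff₂ a b _
  rw [mapHom, mapHom, coeff₂_map₂, coeff₂_map₂]
  exact congrArg (ofDY m n) (RingQuot.mkAlgHom_rel ℂ (h i j k l a b))

theorem map_tSeries {A B : Type*} [Ring A] [Ring B] (φ : A →+* B)
    (x : ℕ → SIdx m n → SIdx m n → A) (i j : SIdx m n) :
    PowerSeries.map φ (tSeries x i j) = tSeries (fun r i j => φ (x r i j)) i j := by
  rw [tSeries, tSeries, map_add, map_mul, map_X]
  congr 1
  split_ifs <;> simp

theorem map_tPlusSeries {A B : Type*} [Ring A] [Ring B] (φ : A →+* B)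
    (x : ℕ → SIdx m n → SIdx m n → A) (i j : SIdx m n) :
    PowerSeries.map φ (tPlusSeries x i j) = tPlusSeries (fun r i j => φ (x r i j)) i j := by
  rw [tPlusSeries, tPlusSeries, map_sub]
  congr 1
  split_ifs <;> simp

variable (m n) in
/-- The matrix entries of `T(u)`, with coefficients in the completion. -/
noncomputable def tHat : SIdx m n → SIdx m n → PowerSeries (DYHat m n) :=
  tSeries fun r i j => ((DY.tPos r i j : DY m n) : DYHat m n)

variable (m n) in
/-- The matrix entries of `T⁺(u)`, with coefficients in the completion. -/
noncomputable def tPlusHat : SIdx m n → SIdx m n → PowerSeries (DYHat m n) :=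
  tPlusSeries fun r i j => ((DY.tNeg r i j : DY m n) : DYHat m n)

theorem map_t (i j : SIdx m n) : PowerSeries.map (ofFree m n : DYFree m n →+* DYHat m n)
    (DYFree.t m n i j) = tHat m n i j :=
  map_tSeries _ _ i j

theorem map_tPlus (i j : SIdx m n) : PowerSeries.map (ofFree m n : DYFree m n →+* DYHat m n)
    (DYFree.tPlus m n i j) = tPlusHat m n i j :=
  map_tPlusSeries _ _ i j

theorem map_val_tPlus (i j : SIdx m n) :
    PowerSeries.map ((extDual m n).val : extDual m n →+* DYHat m n) (tPlus i j) =
      tPlusHat m n i j :=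
  map_tPlusSeries _ _ i j

theorem mapHom_RDual {A B : Type*} [Ring A] [Ring B] (φ : A →+* B) :
    mapHom (map₂ φ) (RDual m n A) = RDual m n B := by
  rw [RDual, RDual, mapHom_sub, mapHom_scale, mapHom_one, mapHom_P, map_sub, map₂_inFst,
    map₂_inSnd, map_X]

theorem dual_relation_hat :
    RDual m n (DYHat m n) ⊙ₛ fst (fun i j => inFst (tPlusHat m n i j)) ⊙ₛ
        snd (fun i j => inSnd (tPlusHat m n i j)) =
      snd (fun i j => inSnd (tPlusHat m n i j)) ⊙ₛ
        fst (fun i j => inFst (tPlusHat m n i j)) ⊙ₛ RDual m n (DYHat m n) := by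
  have h := mapHom_eq_of_rel (fun i j k l a b => DYRel.dual (m := m) (n := n) i j k l a b)
  simpa only [mapHom_mul, mapHom_fst, mapHom_snd, mapHom_RDual, map₂_inFst, map₂_inSnd,
    map_tPlus] using h

/-- The relation holds in the completion and descends along the injective inclusion to `extDual`,
where the contraction must be constructed. -/
theorem dual_relation :
    RDual m n (extDual m n) ⊙ₛ fst (fun i j => inFst (tPlus i j)) ⊙ₛ
        snd (fun i j => inSnd (tPlus i j)) =
      snd (fun i j => inSnd (tPlus i j)) ⊙ₛ
        fst (fun i j => inFst (tPlus i j)) ⊙ₛ RDual m n (extDual m n) := by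
  refine mapHom_injective (map₂_injective
    (φ := ((extDual m n).val : extDual m n →+* DYHat m n)) Subtype.val_injective) ?_
  simpa only [mapHom_mul, mapHom_fst, mapHom_snd, mapHom_RDual, map₂_inFst, map₂_inSnd,
    map_val_tPlus] using dual_relation_hat

variable (m n) in
/-- The element `C / 2`. -/
noncomputable def halfC : DYHat m n := ofFree m n ((1 / 2 : ℂ) • DYFree.c m n)

/-- Commuting with a fixed element is a closed condition, and it holds on the dense image of `DY`.
-/
theorem halfC_mem_center : halfC m n ∈ Subalgebra.center ℂ (DYHat m n) := by
  have hc : DY.proj m n ((1 / 2 : ℂ) • DYFree.c m n) ∈ Subalgebra.center ℂ (DY m n) := by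
    rw [map_smul]
    exact Subalgebra.smul_mem _ DY.c_mem_center _
  rw [Subalgebra.mem_center_iff]
  intro x
  induction x using UniformSpace.Completion.induction_on with
  | hp => exact isClosed_eq (continuous_id.mul continuous_const) (continuous_const.mul continuous_id)
  | ih x =>
    rw [← ofDY_apply]
    change ofDY m n x * ofDY m n _ = ofDY m n _ * ofDY m n x
    rw [← map_mul, ← map_mul]
    exact congrArg (ofDY m n) (Subalgebra.mem_center_iff.1 hc x)

theorem mixed_relation_hat :
    RMixed m n (DYHat m n) (halfC m n) ⊙ₛ fst (fun i j => inFst (tHat m n i j)) ⊙ₛ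
        snd (fun i j => inSnd (tPlusHat m n i j)) =
      snd (fun i j => inSnd (tPlusHat m n i j)) ⊙ₛ
        fst (fun i j => inFst (tHat m n i j)) ⊙ₛ RMixed m n (DYHat m n) (-halfC m n) := by
  have h := mapHom_eq_of_rel (fun i j k l a b => DYRel.mixed (m := m) (n := n) i j k l a b)
  simpa only [mapHom_mul, mapHom_fst, mapHom_snd, mapHom_RMixed, map₂_inFst, map₂_inSnd,
    map_tPlus, map_t, map_neg, ← halfC.eq_1] using h

/-! ## The quantum contraction -/

theorem existsUnique_isQuantumContraction (hmn : m ≠ n) :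
    ∃! z : PowerSeries (extDual m n), IsQuantumContraction z := by
  obtain ⟨s, hsw, hws⟩ := exists_inverse (m := m) (n := n)
  choose W hW using exists_shift (m := m) (n := n) ((m : ℂ) - n)
  obtain ⟨z, hz⟩ := exists_contraction hmn hsw hws (dual_relation_shift dual_relation hW)
  refine ⟨z, ⟨W, snd s, hW, snd_mul_snd_eq_one hws, snd_mul_snd_eq_one hsw, contraction_iff.2 hz⟩,
    ?_⟩
  rintro z' ⟨W', Y, hW', hY, -, hz'⟩
  -- The shifted series is unique because the completion is Hausdorff.
  obtain rfl : W' = W := by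
    funext i j
    exact HasShift.unique (hW' i j) (hW i j)
  obtain rfl := eq_snd_of_mul_eq_one hsw hY
  exact contraction_unique hmn (hz'.symm.trans (contraction_iff.2 hz))

/-- The coefficients of the quantum contraction commute with all `t_{ij}^{(r)}`. -/
theorem tPos_mul_coeff_contraction (hmn : m ≠ n) {z : PowerSeries (extDual m n)}
    (hz : IsQuantumContraction z) (r k : ℕ) (i j : SIdx m n) :
    tPos r i j * incl m n (coeff k z) = incl m n (coeff k z) * tPos r i j := by
  obtain ⟨s, hsw, hws⟩ := exists_inverse (m := m) (n := n)
  obtain ⟨W, Y, hW, hY, -, hz⟩ := hz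
  obtain rfl := eq_snd_of_mul_eq_one hsw hY
  let φ : extDual m n →+* DYHat m n := (extDual m n).val
  have hz' := congrArg (mapHom (PowerSeries.map φ)) hz
  rw [mapHom_contraction_lhs, mapHom_contraction] at hz'
  have hsw' := of_mul_of_map (PowerSeries.map φ) hsw
  have hws' := of_mul_of_map (PowerSeries.map φ) hws
  have hW' : ∀ i j, HasShift ((m : ℂ) - n) (tPlusHat m n i j) (PowerSeries.map φ (W i j)) := by
    intro i j
    rw [← map_val_tPlus]
    exact HasShift.map (extDual m n).val continuous_subtype_val (hW i j)
  simp only [φ, map_val_tPlus] at hsw' hws'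
  -- The commutative ring of central coefficients is taken to be the whole centre of the completion,
  -- which contains C/2.
  have key := inFst_mul_inSnd_contraction hmn (φ := (Subalgebra.center ℂ (DYHat m n)).val)
    (fun c a => (Subalgebra.mem_center_iff.1 c.2 a).symm) ⟨halfC m n, halfC_mem_center⟩
    mixed_relation_hat hW' hsw' hws' hz' i j
  -- The coefficient of u^{-r-1} v^k is taken, since `tPos r` stands for t^{(r+1)}.
  have h2 := congrArg (coeff₂ (r + 1) k) key
  rw [DY.coeff₂_inFst_mul_inSnd, DY.coeff₂_inSnd_mul_inFst, coeff_map, tHat, tSeries, map_add,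
    coeff_succ_X_mul, coeff_mk] at h2
  have h0 : coeff (r + 1) (if i = j then 1 else 0 : PowerSeries (DYHat m n)) = 0 := by
    split_ifs <;> simp [coeff_one]
  rw [h0, zero_add] at h2
  exact Subtype.ext h2

end DYHat

theorem mainTheorem10 (m n : ℕ) (hmn : m ≠ n) :
    (∃! z : PowerSeries (DYHat.extDual m n), DYHat.IsQuantumContraction z) ∧
    ∀ z : PowerSeries (DYHat.extDual m n), DYHat.IsQuantumContraction z →
      ∀ (κ : ℂ) (k : ℕ),
        DYHat.incl m n (PowerSeries.coeff k z) • DYHat.vacuum m n κ ∈ DYHat.invariants m n κ := by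
  refine ⟨DYHat.existsUnique_isQuantumContraction hmn, fun z hz κ k r i j => ?_⟩
  -- The generator is moved past the contraction and then acts on the vacuum, which it annihilates.
  rw [smul_smul, DYHat.tPos_mul_coeff_contraction hmn hz, ← smul_smul]
  have h : DYHat.tPos r i j • DYHat.vacuum m n κ = 0 := by
    change Submodule.Quotient.mk (p := DYHat.vacuumIdeal m n κ) (DYHat.tPos r i j * 1) = 0
    rw [mul_one, Submodule.Quotient.mk_eq_zero]
    exact Ideal.subset_span (Or.inr ⟨r, i, j, rfl⟩)
  rw [h, smul_zero]
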